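/- For $k\in(-1,1)$ let $V_k(x)=\operatorname{sgn}(k)|x|^k$ if $k\ne0$ and $V_0(x)=\log|x|$ (with $V_k(0)=-\infty$ if $k\le 0$). For $\omega\in\mathbb R$ let $\mathcal M^1_\omega$ be the set of Borel probability measures $\mu$ on $\mathbb R$ with $\mu([\omega,\infty))=1$, and put $$E_k(\mu)=\int x^2\,\mu(dx)-\iint V_k(x-y)\,\mu(dx)\mu(dy):=\iint\Big(\tfrac12x^2+\tfrac12y^2-V_k(x-y)\Big)\mu(dx)\mu(dy)\in(-\infty,+\infty],\qquad E^*_{k,\omega}=\inf_{\mu\in\mathcal M^1_\omega}E_k(\mu).$$ **(A) Case $k\in(-1,1)$, $k\neq0$.** Put $$C_k=\frac{\pi(1-k)}{\sin\left(\frac{(1-k)\pi}{2}\right)},\qquad \omega_k=\left(\frac{|k|C_k\Gamma(\frac{4-k}2)}{\sqrt\pi\,\Gamma(\frac{3-k}2)}\right)^{\frac1{2-k}}.$$ For every $\omega\in\mathbb R$ the equation $$(3-k)x^{2-k}+2(2-k)\omega x^{1-k}=\frac{2^{2-k}|k|C_k\Gamma\left(\frac{4-k}{2}\right)}{\sqrt\pi\,\Gamma\left(\frac{3-k}{2}\right)}$$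 has exactly one positive solution $x=L=L_k(\omega)$. Suppose moreover that $\omega\ge-\omega_k$. Then the function $$g_{k,\omega}(t)=\frac1{|k|C_k}(L+\omega-t)^{\frac{1-k}2}(t-\omega)^{-\frac{1+k}2}\left(t-k\omega+\tfrac{1-k}2L\right)$$ is nonnegative on $(\omega,\omega+L]$, the measure $\nu_{k,\omega}$ on $[\omega,\omega+L]$ with density $g_{k,\omega}$ is a probability measure with support $[\omega,\omega+L]$, the function $y\mapsto|x-y|^k$ is $\nu_{k,\omega}$-integrable for every $x\ge\omega$, and there is a constant $S_{k,\omega}\in\mathbb R$ such that $$\tfrac12x^2-\operatorname{sgn}(k)\int|x-y|^k\,\nu_{k,\omega}(dy)\ \begin{cases}=S_{k,\omega},&\omega\le x\le\omega+L,\\ \ge S_{k,\omega},&x\ge\omega+L.\end{cases}$$ Furthermore $\nu_{k,\omega}$ is the constrained equilibrium measure, that is, the unique minimiser of $E_k$ on $\mathcal M^1_\omega$, and the minimal energy is $$\begin{aligned}E^*_{k,\omega}&=\tfrac12(\omega+L)^2-\frac{1+k}{2k}\left(\omega+\tfrac34L\right)L\\&\quad+\Big(L^3\frac{k^2-6k+5}{8(k^2-6k+8)}+\big((3-k)\omega+\tfrac{1-k}2L\big)\frac{k-1}{4(k-2)}L^2+\big((3-2k)\omega+(1-k)L\big)\omega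 L\frac{k-1}{2(k-2)}+\omega^2\big((1-k)\omega+\tfrac{1-k}2L\big)\Big)\\&\qquad\times\frac{\sqrt\pi\,2^{k-2}\,\Gamma\left(\frac12-\frac k2\right)}{|k|C_k\Gamma\left(1-\frac k2\right)}L^{1-k}\\&=\tfrac12(\omega+L)^2-\frac{1+k}{2k}\left(\omega+\tfrac34L\right)L\\&\quad+\frac{\frac{5-k}{8(4-k)}L^3+\frac14\big((3-k)\omega+\frac{1-k}2L\big)L^2+\frac\omega2\big((3-2k)\omega+(1-k)L\big)L+(2-k)\omega^2\big(\omega+\frac12L\big)}{2(2-k)\omega+(3-k)L}.\end{aligned}$$ **(B) Case $k=0$ (Dean–Majumdar).** Let $\omega\ge-\sqrt2$ and $L_0(\omega)=\frac23\left(\sqrt{\omega^2+6}-\omega\right)>0$. Then the function $$g_{0,\omega}(t)=\frac1{2\pi}\sqrt{\frac{L_0(\omega)+\omega-t}{t-\omega}}\,\big(2t+L_0(\omega)\big)$$ is nonnegative on $(\omega,\omega+L_0(\omega)]$, the measure $\nu_{0,\omega}$ on $[\omega,\omega+L_0(\omega)]$ with density $g_{0,\omega}$ is a probability measure with support $[\omega,\omega+L_0(\omega)]$,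 the function $y\mapsto\log|x-y|$ is $\nu_{0,\omega}$-integrable for every $x\ge\omega$, there is a constant $S_{0,\omega}\in\mathbb R$ such that $\frac12x^2-\int\log|x-y|\,\nu_{0,\omega}(dy)$ equals $S_{0,\omega}$ for $\omega\le x\le\omega+L_0(\omega)$ and is at least $S_{0,\omega}$ for $x\ge\omega+L_0(\omega)$, and $\nu_{0,\omega}$ is the unique minimiser of $E_0$ on $\mathcal M^1_\omega$. -/

import Mathlib

open MeasureTheory Set
open scoped ENNReal

noncomputable section

/-- The real repulsion kernel `V_k(x) = sgn(k) |x|^k` for `k ≠ 0`, `V_0(x) = log |x|`,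
with value `-∞` at `x = 0` when `k ≤ 0` (its limit there). -/
def rieszKernel (k x : ℝ) : EReal :=
  if x = 0 ∧ k ≤ 0 then ⊥
  else if k = 0 then ((Real.log |x| : ℝ) : EReal)
  else ((Real.sign k * |x| ^ k : ℝ) : EReal)

/-- The integral of an extended-real function: integral of the positive part minus
integral of the negative part. It is the usual (quasi-)integral whenever at least one of the two
is finite, in particular for functions bounded below and finite measures. -/
def extIntegral {α : Type*} [MeasurableSpace α] (μ : Measure α) (f : α → EReal) : EReal :=
  ((∫⁻ a, (f a).toENNReal ∂μ : ℝ≥0∞) : EReal) - ((∫⁻ a, (-f a).toENNReal ∂μ : ℝ≥0∞) : EReal)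

/-- The energy `E(μ) = ∫ Q dμ - ∬ V_k(x - y) μ(dx) μ(dy)`, written as the integral against `μ ⊗ μ`
of the symmetric kernel `Q(x)/2 + Q(y)/2 - V_k(x - y)`, so that no `∞ - ∞` can occur for
`Q(x) = x ^ 2` and `k < 2` (the kernel is then bounded below). -/
def rieszEnergy (Q : ℝ → ℝ) (k : ℝ) (μ : Measure ℝ) : EReal :=
  extIntegral (μ.prod μ) fun p : ℝ × ℝ =>
    ((Q p.1 / 2 + Q p.2 / 2 : ℝ) : EReal) - rieszKernel k (p.1 - p.2)

/-- Probability measures on `ℝ` carried by `[ω, +∞)`. -/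
def wallMeasures (ω : ℝ) : Set (Measure ℝ) :=
  {μ | IsProbabilityMeasure μ ∧ μ (Ici ω) = 1}

/-- The equilibrium energy `E*_{k,ω}`: the infimum of the energy with `Q(x) = x ^ 2` over all
probability measures carried by `[ω, +∞)`. -/
def wallEnergy (k ω : ℝ) : EReal :=
  ⨅ μ ∈ wallMeasures ω, rieszEnergy (fun x => x ^ 2) k μ

/-- `ν` is the constrained equilibrium measure: the unique minimiser of the energy with
`Q(x) = x ^ 2` among the probability measures carried by `[ω, +∞)`. -/
def IsWallEquilibrium (k ω : ℝ) (ν : Measure ℝ) : Prop :=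
  ν ∈ wallMeasures ω ∧ rieszEnergy (fun x => x ^ 2) k ν = wallEnergy k ω ∧
    ∀ μ ∈ wallMeasures ω, rieszEnergy (fun x => x ^ 2) k μ = wallEnergy k ω → μ = ν

/-- The measure on the interval `[ω, ω + L]` with density `g`. -/
def intervalMeasure (ω L : ℝ) (g : ℝ → ℝ) : Measure ℝ :=
  (volume.restrict (Icc ω (ω + L))).withDensity fun t => ENNReal.ofReal (g t)

/-- `C_k = π (1 - k) / sin ((1 - k) π / 2)`. -/
def wallC (k : ℝ) : ℝ :=
  Real.pi * (1 - k) / Real.sin ((1 - k) * Real.pi / 2)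

/-- The algebraic equation in `x` satisfied by the length `L_k(ω)` of the support. -/
def WallLengthEq (k ω x : ℝ) : Prop :=
  (3 - k) * x ^ (2 - k) + 2 * (2 - k) * ω * x ^ (1 - k) =
    2 ^ (2 - k) * |k| * wallC k * Real.Gamma ((4 - k) / 2) /
      (√Real.pi * Real.Gamma ((3 - k) / 2))

/-- The half-length `ω_k` of the support of the unconstrained equilibrium measure; the wall at `ω`
pushes the particles exactly when `-ω_k < ω`. -/
def criticalWall (k : ℝ) : ℝ :=
  (|k| * wallC k * Real.Gamma ((4 - k) / 2) /
    (√Real.pi * Real.Gamma ((3 - k) / 2))) ^ (1 / (2 - k))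

/-- The density `g_{k,ω}`, with `L` standing for `L_k(ω)`. -/
def wallDensity (k ω L t : ℝ) : ℝ :=
  1 / (|k| * wallC k) * (L + ω - t) ^ ((1 - k) / 2) * (t - ω) ^ (-((1 + k) / 2)) *
    (t - k * ω + (1 - k) / 2 * L)

/-- The length `L_0(ω)` of the support in the logarithmic case. -/
def logWallLength (ω : ℝ) : ℝ :=
  2 / 3 * (√(ω ^ 2 + 6) - ω)

/-- The density `g_{0,ω}` in the logarithmic case. -/
def logWallDensity (ω t : ℝ) : ℝ :=
  1 / (2 * Real.pi) * √((logWallLength ω + ω - t) / (t - ω)) * (2 * t + logWallLength ω)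

/-- The value of the equilibrium energy, first form, with `L` standing for `L_k(ω)`. -/
def wallEnergyValue (k ω L : ℝ) : ℝ :=
  1 / 2 * (ω + L) ^ 2 - (1 + k) / (2 * k) * (ω + 3 / 4 * L) * L +
    (L ^ 3 * ((k ^ 2 - 6 * k + 5) / (8 * (k ^ 2 - 6 * k + 8))) +
      ((3 - k) * ω + (1 - k) / 2 * L) * ((k - 1) / (4 * (k - 2))) * L ^ 2 +
      ((3 - 2 * k) * ω + (1 - k) * L) * ω * L * ((k - 1) / (2 * (k - 2))) +
      ω ^ 2 * ((1 - k) * ω + (1 - k) / 2 * L)) *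
    (√Real.pi * 2 ^ (k - 2) * Real.Gamma (1 / 2 - k / 2) /
      (|k| * wallC k * Real.Gamma (1 - k / 2))) * L ^ (1 - k)

/-- The value of the equilibrium energy, second form: the power of `L` is eliminated. -/
def wallEnergyValue' (k ω L : ℝ) : ℝ :=
  1 / 2 * (ω + L) ^ 2 - (1 + k) / (2 * k) * (ω + 3 / 4 * L) * L +
    ((5 - k) / (8 * (4 - k)) * L ^ 3 +
      1 / 4 * ((3 - k) * ω + (1 - k) / 2 * L) * L ^ 2 +
      ω / 2 * ((3 - 2 * k) * ω + (1 - k) * L) * L +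
      (2 - k) * ω ^ 2 * (ω + 1 / 2 * L)) /
    (2 * (2 - k) * ω + (3 - k) * L)

end

/-! The energy is strictly convex on measures of finite energy, so a candidate satisfying the
Euler–Lagrange conditions is the unique minimiser: its potential must equal `x ^ 2 / 2 - S` on its
support and stay below that parabola on the rest of the half-line
(`isWallEquilibrium_of_potential`). Two facts are needed, the conditions for the given density and
strict positive definiteness of `-V_k` on differences of probability measures.

For the first, let `h = L / 2` and rescale the support to `[-1, 1]`. The density becomes a constant
times `(1 - s) * (h * s + A)` times the weight `w(s) = (1 - s ^ 2) ^ ((1 - k) / 2 - 1)`. The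
potential of `w` is constant on the interval (`hasIntegralOn_riesz_gegenbauer` and
`hasIntegralOn_log_arcsine`), by a Möbius substitution for powers and by the circle average of `log
|z - a|` for the logarithm. Integrating a potential in its variable and exchanging the integrals
raises the moment by one (`potential_recursion`), so the potentials of `s w` and `s ^ 2 w` are
polynomials of degree 1 and 2. The constant `A` makes the resulting quadratic agree with `x ^ 2 / 2
- S`. To the right of the endpoint `b`, concavity of the kernel keeps the potential below its
tangent at `b`, whose slope is exactly `b`, while `x ^ 2 / 2` lies above its own tangent there. The
restriction on `ω` amounts to `-h ≤ ω`, which is nonnegativity of the density.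

For the second, `V_k(1) - V_k(x)` is a positive multiple of the integral over `r > 0` of `r ^ (k -
2)` times the difference of the tents of half-width `r` at `x` and at `1`. A tent is the
autocorrelation of the indicator of a window of length `r`, so the energy of a difference of
probability measures is a weighted integral of squared differences of window masses
(`mutual_energy_inequality`). It vanishes only if the measures coincide.

The minimal energy is `S` plus half the second moment. For `k ≠ 0`, `S` is read off at the right
endpoint, where the potential reduces to beta integrals. -/

/-- `f` is integrable on `s`, with integral `I`. -/
def HasIntegralOn (f : ℝ → ℝ) (s : Set ℝ) (I : ℝ) : Prop :=
  IntegrableOn f s ∧ ∫ x in s, f x = I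

/-! ### Integrals with a prescribed value, and changes of variable -/

namespace HasIntegralOn

variable {f g : ℝ → ℝ} {s : Set ℝ} {I J : ℝ}

theorem add (hf : HasIntegralOn f s I) (hg : HasIntegralOn g s J) :
    HasIntegralOn (fun x => f x + g x) s (I + J) :=
  ⟨hf.1.add hg.1, by rw [integral_add hf.1 hg.1, hf.2, hg.2]⟩

theorem sub (hf : HasIntegralOn f s I) (hg : HasIntegralOn g s J) :
    HasIntegralOn (fun x => f x - g x) s (I - J) :=
  ⟨hf.1.sub hg.1, by rw [integral_sub hf.1 hg.1, hf.2, hg.2]⟩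

theorem const_mul (c : ℝ) (hf : HasIntegralOn f s I) :
    HasIntegralOn (fun x => c * f x) s (c * I) :=
  ⟨hf.1.const_mul c, by rw [integral_const_mul, hf.2]⟩

theorem congr (hf : HasIntegralOn f s I) (hs : MeasurableSet s) (h : ∀ x ∈ s, f x = g x)
    (hI : I = J) : HasIntegralOn g s J :=
  ⟨hf.1.congr_fun h hs, by rw [← setIntegral_congr_fun hs h, hf.2, hI]⟩

theorem image_iff {φ φ' : ℝ → ℝ} (hs : MeasurableSet s)
    (hφ' : ∀ x ∈ s, HasDerivAt φ (φ' x) x) (hφ : InjOn φ s) :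
    HasIntegralOn f (φ '' s) I ↔ HasIntegralOn (fun x => |φ' x| * f (φ x)) s I := by
  have h1 : ∀ x ∈ s, HasDerivWithinAt φ (φ' x) s x := fun x hx => (hφ' x hx).hasDerivWithinAt
  unfold HasIntegralOn
  rw [integrableOn_image_iff_integrableOn_abs_deriv_smul hs h1 hφ,
    integral_image_eq_integral_abs_deriv_smul hs h1 hφ]
  rfl

theorem comp_affine {a b c d : ℝ} (hd : 0 < d)
    (hf : HasIntegralOn f (Ioo (c + d * a) (c + d * b)) I) :
    HasIntegralOn (fun x => d * f (c + d * x)) (Ioo a b) I := by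
  have him : (fun x => c + d * x) '' Ioo a b = Ioo (c + d * a) (c + d * b) := by
    ext y
    constructor
    · rintro ⟨x, ⟨h1, h2⟩, rfl⟩
      constructor <;> simp only <;> gcongr
    · rintro ⟨h1, h2⟩
      refine ⟨(y - c) / d, ⟨?_, ?_⟩, by simp only; field_simp; ring⟩
      · rw [lt_div_iff₀ hd]; linarith
      · rw [div_lt_iff₀ hd]; linarith
  rw [← him, image_iff (φ' := fun _ => d) measurableSet_Ioo] at hf
  · simpa [abs_of_pos hd] using hf
  · intro x _
    simpa using ((hasDerivAt_id x).const_mul d).const_add c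
  · intro x _ y _ h
    have : d * x = d * y := by simpa using h
    exact mul_left_cancel₀ hd.ne' this

theorem comp_affine_iff {a b c d : ℝ} (hd : 0 < d) :
    HasIntegralOn (fun x => d * f (c + d * x)) (Ioo a b) I ↔
      HasIntegralOn f (Ioo (c + d * a) (c + d * b)) I := by
  refine ⟨fun h => ?_, comp_affine hd⟩
  have h2 : HasIntegralOn (fun x => d * f (c + d * x))
      (Ioo (-c / d + d⁻¹ * (c + d * a)) (-c / d + d⁻¹ * (c + d * b))) I := by
    convert h using 2 <;> field_simp <;> ring
  refine (comp_affine (inv_pos.2 hd) h2).congr measurableSet_Ioo (fun x _ => ?_) rfl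
  rw [show c + d * (-c / d + d⁻¹ * x) = x by field_simp; ring]
  field_simp

end HasIntegralOn

/-! ### Beta integrals and moments of the Gegenbauer weight -/

/-- The Euler beta integral on `(0, 1)`. -/
theorem hasIntegralOn_beta {a b : ℝ} (ha : 0 < a) (hb : 0 < b) :
    HasIntegralOn (fun x => x ^ (a - 1) * (1 - x) ^ (b - 1)) (Ioo 0 1)
      (ProbabilityTheory.beta a b) := by
  have h : ∫ x in Ioo (0 : ℝ) 1, x ^ (a - 1) * (1 - x) ^ (b - 1) =
      ProbabilityTheory.beta a b := by
    rw [ProbabilityTheory.beta_eq_betaIntegralReal a b ha hb, Complex.betaIntegral,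
      intervalIntegral.integral_of_le (by norm_num), ← integral_Ioc_eq_integral_Ioo]
    rw [← RCLike.re_eq_complex_re, ← integral_re]
    · refine setIntegral_congr_fun measurableSet_Ioc fun x ⟨hx1, hx2⟩ => ?_
      norm_cast
      rw [← Complex.ofReal_cpow, ← Complex.ofReal_cpow, ← Complex.ofReal_mul]
      · simp
      all_goals linarith
    · have := Complex.betaIntegral_convergent (u := a) (v := b) (by simpa) (by simpa)
      rwa [intervalIntegrable_iff_integrableOn_Ioc_of_le (by simp)] at this
  -- The integral of a non-integrable function is `0` by convention, so a positive value already
  -- yields integrability.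
  exact ⟨Integrable.of_integral_ne_zero
    (by rw [h]; exact (ProbabilityTheory.beta_pos ha hb).ne'), h⟩

/-- The Euler beta integral on `(-1, 1)`. -/
theorem hasIntegralOn_beta_symm {a b : ℝ} (ha : 0 < a) (hb : 0 < b) :
    HasIntegralOn (fun s => (1 - s) ^ (a - 1) * (1 + s) ^ (b - 1)) (Ioo (-1) 1)
      (2 ^ (a + b - 1) * ProbabilityTheory.beta a b) := by
  have h := (hasIntegralOn_beta hb ha).const_mul (2 ^ (a + b - 1))
  have h2 : HasIntegralOn (fun x : ℝ => (2 : ℝ) ^ (a + b - 1) * (x ^ (b - 1) * (1 - x) ^ (a - 1)))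
    (Ioo (1 / 2 + 1 / 2 * (-1)) (1 / 2 + 1 / 2 * 1))
      (2 ^ (a + b - 1) * ProbabilityTheory.beta b a) := by
    norm_num; exact h
  refine (h2.comp_affine (by norm_num)).congr measurableSet_Ioo (fun s ⟨h1, h2⟩ => ?_) ?_
  · have e1 : (1 : ℝ) / 2 + 1 / 2 * s = (1 + s) / 2 := by ring
    have e2 : (1 : ℝ) - (1 + s) / 2 = (1 - s) / 2 := by ring
    rw [e1, e2, Real.div_rpow (by linarith) (by norm_num), Real.div_rpow (by linarith) (by norm_num),
      show a + b - 1 = (a - 1) + (b - 1) + 1 by ring, Real.rpow_add (by norm_num),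
      Real.rpow_add (by norm_num), Real.rpow_one]
    have := Real.rpow_pos_of_pos (show (0 : ℝ) < 2 by norm_num) (a - 1)
    have := Real.rpow_pos_of_pos (show (0 : ℝ) < 2 by norm_num) (b - 1)
    field_simp
  · rw [ProbabilityTheory.beta, ProbabilityTheory.beta, add_comm b a, mul_comm (Real.Gamma b)]

/-- The mass of the weight `(1 - s ^ 2) ^ (a - 1)` on `(-1, 1)`. -/
noncomputable def gegenbauerMass (a : ℝ) : ℝ := 2 ^ (a + a - 1) * ProbabilityTheory.beta a a

theorem gegenbauerMass_pos {a : ℝ} (ha : 0 < a) : 0 < gegenbauerMass a :=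
  mul_pos (by positivity) (ProbabilityTheory.beta_pos ha ha)

theorem gegenbauerMass_add_one {a : ℝ} (ha : 0 < a) :
    gegenbauerMass (a + 1) = 2 * a / (2 * a + 1) * gegenbauerMass a := by
  unfold gegenbauerMass ProbabilityTheory.beta
  rw [show a + 1 + (a + 1) - 1 = (a + a - 1) + 2 by ring, Real.rpow_add (by norm_num),
    show a + 1 + (a + 1) = (a + a + 1) + 1 by ring, Real.Gamma_add_one (by positivity : a + a + 1 ≠ 0),
    Real.Gamma_add_one (by positivity : a + a ≠ 0), Real.Gamma_add_one ha.ne']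
  have := (Real.Gamma_pos_of_pos (show 0 < a + a by positivity)).ne'
  field_simp
  norm_num
  ring

/-- Legendre's duplication formula; this is the shape in which the mass meets the Gamma quotients of
the length equation and of the energy. -/
theorem gegenbauerMass_eq {a : ℝ} (ha : 0 < a) :
    gegenbauerMass a = √Real.pi * Real.Gamma a / Real.Gamma (a + 1 / 2) := by
  have h := Real.Gamma_mul_Gamma_add_half a
  unfold gegenbauerMass ProbabilityTheory.beta
  have h1 := (Real.Gamma_pos_of_pos (show 0 < a + a by positivity)).ne'
  have h2 := (Real.Gamma_pos_of_pos (show 0 < a + 1 / 2 by positivity)).ne'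
  have h3 : (2 : ℝ) ^ (a + a - 1) * 2 ^ (1 - 2 * a) = 1 := by
    rw [← Real.rpow_add (by norm_num)]
    ring_nf
    exact Real.rpow_zero 2
  rw [← two_mul] at h1 h3 ⊢
  generalize Real.Gamma (a + 1 / 2) = G at h h2 ⊢
  field_simp
  linear_combination (2 ^ (2 * a - 1) : ℝ) * h + Real.Gamma (2 * a) * √Real.pi * h3

theorem hasIntegralOn_gegenbauer {a : ℝ} (ha : 0 < a) :
    HasIntegralOn (fun s => (1 - s ^ 2) ^ (a - 1)) (Ioo (-1) 1) (gegenbauerMass a) := by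
  refine (hasIntegralOn_beta_symm ha ha).congr measurableSet_Ioo (fun s ⟨h1, h2⟩ => ?_) rfl
  rw [← Real.mul_rpow (by linarith) (by linarith)]
  congr 1; ring

theorem hasIntegralOn_of_odd {f : ℝ → ℝ} {a : ℝ} (hf : IntegrableOn f (Ioo (-a) a))
    (h : ∀ x, f (-x) = - f x) : HasIntegralOn f (Ioo (-a) a) 0 := by
  refine ⟨hf, ?_⟩
  rcases le_total a (-a) with h0 | h0
  · rw [Ioo_eq_empty (by linarith)]; simp
  rw [← integral_Ioc_eq_integral_Ioo, ← intervalIntegral.integral_of_le (by linarith)]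
  have h1 := intervalIntegral.integral_comp_neg (a := -a) (b := a) f
  simp only [h, neg_neg, intervalIntegral.integral_neg] at h1
  linarith

theorem IntegrableOn.pow_mul_Ioo {f : ℝ → ℝ} (hf : IntegrableOn f (Ioo (-1) 1)) (n : ℕ) :
    IntegrableOn (fun s => s ^ n * f s) (Ioo (-1) 1) := by
  refine Integrable.bdd_mul (c := 1) hf (by fun_prop) ?_
  filter_upwards [ae_restrict_mem measurableSet_Ioo] with s hs
  rw [norm_pow]
  exact pow_le_one₀ (norm_nonneg _) (abs_le.2 ⟨hs.1.le, hs.2.le⟩)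

theorem hasIntegralOn_gegenbauer_odd {a : ℝ} (ha : 0 < a) {n : ℕ} (hn : Odd n) :
    HasIntegralOn (fun s => s ^ n * (1 - s ^ 2) ^ (a - 1)) (Ioo (-1) 1) 0 :=
  hasIntegralOn_of_odd (IntegrableOn.pow_mul_Ioo (hasIntegralOn_gegenbauer ha).1 n) fun x => by
    rw [hn.neg_pow, neg_sq]; ring

/-- Since `s ^ 2 = 1 - (1 - s ^ 2)`, two more powers of `s` cost a difference of two weights with
consecutive exponents. The fourth moment follows from the second in the same way. -/
theorem hasIntegralOn_gegenbauer_two {a : ℝ} (ha : 0 < a) :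
    HasIntegralOn (fun s => s ^ 2 * (1 - s ^ 2) ^ (a - 1)) (Ioo (-1) 1)
      (gegenbauerMass a / (2 * a + 1)) := by
  refine ((hasIntegralOn_gegenbauer ha).sub
    (hasIntegralOn_gegenbauer (a := a + 1) (by linarith))).congr measurableSet_Ioo
    (fun s ⟨h1, h2⟩ => ?_) ?_
  · have : 0 < 1 - s ^ 2 := by nlinarith
    rw [show a + 1 - 1 = (a - 1) + 1 by ring, Real.rpow_add this, Real.rpow_one]; ring
  · rw [gegenbauerMass_add_one ha]; field_simp; ring

theorem hasIntegralOn_gegenbauer_four {a : ℝ} (ha : 0 < a) :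
    HasIntegralOn (fun s => s ^ 4 * (1 - s ^ 2) ^ (a - 1)) (Ioo (-1) 1)
      (3 * gegenbauerMass a / ((2 * a + 1) * (2 * a + 3))) := by
  refine ((hasIntegralOn_gegenbauer_two ha).sub
    (hasIntegralOn_gegenbauer_two (a := a + 1) (by linarith))).congr measurableSet_Ioo
    (fun s ⟨h1, h2⟩ => ?_) ?_
  · have : 0 < 1 - s ^ 2 := by nlinarith
    rw [show a + 1 - 1 = (a - 1) + 1 by ring, Real.rpow_add this, Real.rpow_one]; ring
  · rw [gegenbauerMass_add_one ha]
    have : 2 * a + 1 + 2 ≠ 0 := by positivity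
    field_simp; ring

/-! ### Constancy of the Riesz potential of the weight -/

/-- The Möbius substitutions used below are their own inverses, so invariance of `s` gives
surjectivity and injectivity at once. -/
theorem HasIntegralOn.comp_involution {f φ φ' : ℝ → ℝ} {s : Set ℝ} {I : ℝ}
    (hf : HasIntegralOn f s I) (hs : MeasurableSet s) (hφ' : ∀ x ∈ s, HasDerivAt φ (φ' x) x)
    (hmaps : ∀ x ∈ s, φ x ∈ s) (hinv : ∀ x ∈ s, φ (φ x) = x) :
    HasIntegralOn (fun x => |φ' x| * f (φ x)) s I := by
  rw [← HasIntegralOn.image_iff hs hφ']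
  · have : φ '' s = s :=
      (image_subset_iff.2 hmaps).antisymm fun x hx => ⟨φ x, hmaps x hx, hinv x hx⟩
    rwa [this]
  · intro x hx y hy h
    rw [← hinv x hx, h, hinv y hy]

theorem HasIntegralOn.of_even {f : ℝ → ℝ} {a I : ℝ} (ha : 0 ≤ a) (hf : HasIntegralOn f (Ioo 0 a) I)
    (h : ∀ x, f (-x) = f x) : HasIntegralOn f (Ioo (-a) a) (2 * I) := by
  have h1 : IntervalIntegrable f volume 0 a := by
    rw [intervalIntegrable_iff_integrableOn_Ioo_of_le ha]; exact hf.1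
  have h2 : IntervalIntegrable f volume (-a) 0 := by
    have := (IntervalIntegrable.iff_comp_neg (f := f) (a := 0) (b := a)).1 h1 |>.symm
    simpa [h] using this
  have h3 := intervalIntegral.integral_comp_neg (a := 0) (b := a) f
  simp only [h, neg_zero] at h3
  have h4 := intervalIntegral.integral_add_adjacent_intervals h2 h1
  refine ⟨(intervalIntegrable_iff_integrableOn_Ioo_of_le (by linarith)).1 (h2.trans h1), ?_⟩
  rw [← integral_Ioc_eq_integral_Ioo, ← intervalIntegral.integral_of_le (by linarith), ← h4, ← h3,
    ← hf.2, ← integral_Ioc_eq_integral_Ioo, ← intervalIntegral.integral_of_le ha]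
  ring

theorem beta_one_sub {p : ℝ} :
    ProbabilityTheory.beta p (1 - p) = Real.pi / Real.sin (Real.pi * p) := by
  rw [ProbabilityTheory.beta, Real.Gamma_mul_Gamma_one_sub]
  simp

theorem beta_one_sub' {p : ℝ} :
    ProbabilityTheory.beta (1 - p) p = Real.pi / Real.sin (Real.pi * p) := by
  rw [ProbabilityTheory.beta, mul_comm, Real.Gamma_mul_Gamma_one_sub]
  simp

/-- Euler's integral for `₂F₁(1, 1 - p; 1; z)`. -/
theorem hasIntegralOn_euler {p z : ℝ} (hp : p ∈ Ioo 0 1) (hz0 : 0 ≤ z) (hz1 : z < 1) :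
    HasIntegralOn (fun τ => τ ^ (-p) * (1 - τ) ^ (p - 1) / (1 - z * τ)) (Ioo 0 1)
      ((1 - z) ^ (p - 1) * (Real.pi / Real.sin (Real.pi * p))) := by
  have h := hasIntegralOn_beta hp.1 (sub_pos.2 hp.2)
  rw [beta_one_sub] at h
  have hpos : ∀ τ ∈ Ioo (0 : ℝ) 1, 0 < 1 - z * τ := fun τ ⟨h1, h2⟩ => by nlinarith
  -- This involution of `(0, 1)` sends `1 - τ` to `τ * (1 - z) / (1 - z * τ)`. The exponents `p - 1`
  -- and `-p` add up to `-1`, so together with the Jacobian a single factor `1 / (1 - z * τ)`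
  -- survives.
  have h' := (h.comp_involution (φ := fun τ => (1 - τ) / (1 - z * τ))
    (φ' := fun τ => -(1 - z) / (1 - z * τ) ^ 2) measurableSet_Ioo ?_ ?_ ?_)
  · refine (h'.const_mul ((1 - z) ^ (p - 1))).congr measurableSet_Ioo (fun τ hτ => ?_) rfl
    have h0 := hpos τ hτ
    have h0' : 1 - τ * z ≠ 0 := by rw [mul_comm]; exact h0.ne'
    obtain ⟨h1, h2⟩ := hτ
    have e : 1 - (1 - τ) / (1 - z * τ) = τ * (1 - z) / (1 - z * τ) := by field_simp; ring
    rw [e, abs_div, abs_neg, abs_of_pos (by linarith), abs_of_pos (by positivity),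
      Real.div_rpow (by linarith) h0.le, Real.div_rpow (by nlinarith) h0.le,
      Real.mul_rpow h1.le (by linarith), show 1 - p - 1 = -p by ring]
    have hz2 : (0 : ℝ) < 1 - z := by linarith
    have a1 : (1 - z) ^ (p - 1) * (1 - z) ^ (-p) * (1 - z) = 1 := by
      rw [← Real.rpow_add hz2, ← Real.rpow_add_one hz2.ne', show p - 1 + -p + 1 = 0 by ring,
        Real.rpow_zero]
    have a2 : (1 - z * τ) ^ (p - 1) * (1 - z * τ) ^ (-p) * (1 - z * τ) = 1 := by
      rw [← Real.rpow_add h0, ← Real.rpow_add_one h0.ne', show p - 1 + -p + 1 = 0 by ring,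
        Real.rpow_zero]
    have b1 := Real.rpow_pos_of_pos h0 (p - 1)
    have b2 := Real.rpow_pos_of_pos h0 (-p)
    generalize (1 - z * τ) ^ (p - 1) = u at *
    generalize (1 - z * τ) ^ (-p) = v at *
    generalize (1 - z) ^ (p - 1) = u' at *
    generalize (1 - z) ^ (-p) = v' at *
    field_simp
    linear_combination a1 - a2
  · intro τ hτ
    have h0 := (hpos τ hτ).ne'
    refine (((hasDerivAt_id' τ).const_sub 1).div
      (((hasDerivAt_id' τ).const_mul z).const_sub 1) h0).congr_deriv ?_
    ring
  · intro τ hτ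
    have h0 := hpos τ hτ
    refine ⟨div_pos (by linarith [hτ.2]) h0, ?_⟩
    rw [div_lt_one h0]; nlinarith [hτ.1]
  · intro τ hτ
    have h0 := hpos τ hτ
    have h0' : 1 - τ * z ≠ 0 := by rw [mul_comm]; exact h0.ne'
    have : 1 - z * ((1 - τ) / (1 - z * τ)) = (1 - z) / (1 - z * τ) := by field_simp; ring
    have h3 : 1 - z ≠ 0 := by linarith
    simp only [this]
    field_simp
    ring

/-- Substitute `τ = t ^ 2` on `(0, 1)` and reflect. -/
theorem hasIntegralOn_euler_even {p z : ℝ} (hp : p ∈ Ioo 0 1) (hz0 : 0 ≤ z) (hz1 : z < 1) :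
    HasIntegralOn (fun t => |t| ^ (1 - 2 * p) * (1 - t ^ 2) ^ (p - 1) / (1 - z * t ^ 2))
      (Ioo (-1) 1) ((1 - z) ^ (p - 1) * (Real.pi / Real.sin (Real.pi * p))) := by
  have h := hasIntegralOn_euler hp hz0 hz1
  have him : (fun t : ℝ => t ^ 2) '' Ioo 0 1 = Ioo 0 1 := by
    ext y
    constructor
    · rintro ⟨x, ⟨h1, h2⟩, rfl⟩
      exact ⟨by positivity, by simp only; nlinarith⟩
    · rintro ⟨h1, h2⟩
      exact ⟨√y, ⟨Real.sqrt_pos.2 h1, (Real.sqrt_lt' one_pos).2 (by simpa using h2)⟩,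
        Real.sq_sqrt h1.le⟩
  rw [← him, HasIntegralOn.image_iff (φ' := fun t => 2 * t) measurableSet_Ioo] at h
  · have h2 : HasIntegralOn (fun t => |t| ^ (1 - 2 * p) * (1 - t ^ 2) ^ (p - 1) / (1 - z * t ^ 2))
        (Ioo 0 1) (1 / 2 * ((1 - z) ^ (p - 1) * (Real.pi / Real.sin (Real.pi * p)))) := by
      refine (h.const_mul (1 / 2)).congr measurableSet_Ioo (fun t ⟨h1, h2⟩ => ?_) rfl
      rw [abs_of_pos h1, abs_of_pos (by linarith), ← Real.rpow_natCast t 2, ← Real.rpow_mul h1.le,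
        show (1 : ℝ) - 2 * p = (2 : ℕ) * -p + 1 by push_cast; ring, Real.rpow_add_one h1.ne']
      ring
    convert h2.of_even zero_le_one (fun x => by simp) using 1
    ring
  · intro t _
    simpa using hasDerivAt_pow 2 t
  · intro x hx y hy h
    exact (pow_left_inj₀ hx.1.le hy.1.le two_ne_zero).1 h

/-- The Riesz potential of the arcsine-type weight is constant on the interval. -/
theorem hasIntegralOn_riesz_gegenbauer {p ξ : ℝ} (hp : p ∈ Ioo 0 1) (hξ : ξ ∈ Icc (-1) 1) :
    HasIntegralOn (fun s => |ξ - s| ^ (1 - 2 * p) * (1 - s ^ 2) ^ (p - 1)) (Ioo (-1) 1)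
      (Real.pi / Real.sin (Real.pi * p)) := by
  -- At `ξ = ±1` the Möbius map below degenerates, but the integrand is then a pure beta integrand.
  rcases hξ.1.eq_or_lt with rfl | h1
  · have h := hasIntegralOn_beta_symm hp.1 (sub_pos.2 hp.2)
    refine h.congr measurableSet_Ioo (fun s ⟨h1, h2⟩ => ?_) ?_
    · rw [show -1 - s = -(1 + s) by ring, abs_neg, abs_of_pos (by linarith),
        show 1 - s ^ 2 = (1 - s) * (1 + s) by ring, Real.mul_rpow (by linarith) (by linarith),
        show 1 - p - 1 = (1 - 2 * p) + (p - 1) by ring, Real.rpow_add (by linarith : 0 < 1 + s)]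
      ring
    · rw [beta_one_sub]; simp
  rcases hξ.2.eq_or_lt with rfl | h2
  · have h := hasIntegralOn_beta_symm (sub_pos.2 hp.2) hp.1
    refine h.congr measurableSet_Ioo (fun s ⟨h1, h2⟩ => ?_) ?_
    · rw [abs_of_pos (by linarith),
        show 1 - s ^ 2 = (1 - s) * (1 + s) by ring, Real.mul_rpow (by linarith) (by linarith),
        show 1 - p - 1 = (1 - 2 * p) + (p - 1) by ring, Real.rpow_add (by linarith : 0 < 1 - s)]
      ring
    · rw [beta_one_sub']; simp
  have hz : ξ ^ 2 < 1 := by nlinarith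
  have hE := hasIntegralOn_euler_even hp (sq_nonneg ξ) hz
  -- Since `1 / (1 - ξ * t) = (1 + ξ * t) / (1 - ξ ^ 2 * t ^ 2)`, the integral with denominator `1 -
  -- ξ * t` has an even part given by Euler's integral and an odd part that vanishes.
  have hO := hasIntegralOn_of_odd (a := 1)
    (f := fun t => t ^ 1 * (|t| ^ (1 - 2 * p) * (1 - t ^ 2) ^ (p - 1) / (1 - ξ ^ 2 * t ^ 2)))
    (IntegrableOn.pow_mul_Ioo hE.1 1) (fun x => by simp)
  have hpos : ∀ t ∈ Ioo (-1 : ℝ) 1, 0 < 1 - ξ * t := fun t ⟨h3, h4⟩ => by nlinarith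
  have hpos' : ∀ t ∈ Ioo (-1 : ℝ) 1, 0 < 1 + ξ * t := fun t ⟨h3, h4⟩ => by nlinarith
  have hF : HasIntegralOn (fun t => |t| ^ (1 - 2 * p) * (1 - t ^ 2) ^ (p - 1) / (1 - ξ * t))
      (Ioo (-1) 1) ((1 - ξ ^ 2) ^ (p - 1) * (Real.pi / Real.sin (Real.pi * p))) := by
    refine (hE.add (hO.const_mul ξ)).congr measurableSet_Ioo (fun t ht => ?_) (by ring)
    have a1 := (hpos t ht).ne'
    have a2 := (hpos' t ht).ne'
    rw [show 1 - ξ ^ 2 * t ^ 2 = (1 - ξ * t) * (1 + ξ * t) by ring, pow_one, ← mul_assoc,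
      ← mul_div_assoc, ← add_div, div_eq_div_iff (mul_ne_zero a1 a2) a1]
    ring
  have hr : 0 < 1 - ξ ^ 2 := by linarith
  -- This involution of `(-1, 1)` exchanges `0` and `ξ`, turning the singularity of `|t|` at the
  -- origin into that of `|ξ - t|`.
  have hd : ∀ t ∈ Ioo (-1 : ℝ) 1, HasDerivAt (fun t => (ξ - t) / (1 - ξ * t))
      (-(1 - ξ ^ 2) / (1 - ξ * t) ^ 2) t := fun t ht => by
    refine (((hasDerivAt_id' t).const_sub ξ).div
      (((hasDerivAt_id' t).const_mul ξ).const_sub 1) (hpos t ht).ne').congr_deriv ?_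
    ring
  have hmaps : ∀ t ∈ Ioo (-1 : ℝ) 1, (ξ - t) / (1 - ξ * t) ∈ Ioo (-1 : ℝ) 1 := fun t ht => by
    have a1 := hpos t ht
    constructor
    · rw [lt_div_iff₀ a1]; nlinarith [ht.1, ht.2]
    · rw [div_lt_one a1]; nlinarith [ht.1, ht.2]
  have hinv : ∀ t ∈ Ioo (-1 : ℝ) 1,
      (ξ - (ξ - t) / (1 - ξ * t)) / (1 - ξ * ((ξ - t) / (1 - ξ * t))) = t := fun t ht => by
    have a1 := hpos t ht
    have a1' : 1 - t * ξ ≠ 0 := by rw [mul_comm]; exact a1.ne'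
    have a2 : 1 - ξ * ((ξ - t) / (1 - ξ * t)) = (1 - ξ ^ 2) / (1 - ξ * t) := by field_simp; ring
    rw [a2]
    field_simp
    ring
  refine ((hF.comp_involution measurableSet_Ioo hd hmaps hinv).const_mul
    ((1 - ξ ^ 2) ^ (1 - p))).congr measurableSet_Ioo (fun t ht => ?_) ?_
  · have a1 := hpos t ht
    have a1' : 1 - t * ξ ≠ 0 := by rw [mul_comm]; exact a1.ne'
    have a3 : 0 < 1 - t ^ 2 := by nlinarith [ht.1, ht.2]
    have a2 : 1 - ξ * ((ξ - t) / (1 - ξ * t)) = (1 - ξ ^ 2) / (1 - ξ * t) := by field_simp; ring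
    have a4 : 1 - ((ξ - t) / (1 - ξ * t)) ^ 2 = (1 - ξ ^ 2) * (1 - t ^ 2) / (1 - ξ * t) ^ 2 := by
      field_simp; ring
    rw [a2, a4, abs_div, abs_neg, abs_of_pos hr, abs_of_pos (by positivity), abs_div,
      abs_of_pos a1, Real.div_rpow (abs_nonneg _) a1.le, Real.div_rpow (by positivity)
      (by positivity), Real.mul_rpow hr.le a3.le, ← Real.rpow_natCast (1 - ξ * t) 2,
      ← Real.rpow_mul a1.le, show 1 - p = -(p - 1) by ring, Real.rpow_neg hr.le,
      show ((2 : ℕ) : ℝ) * (p - 1) = -((1 - 2 * p) + 1) by push_cast; ring,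
      Real.rpow_neg a1.le, Real.rpow_add_one a1.ne']
    have b1 := Real.rpow_pos_of_pos a1 (1 - 2 * p)
    have b2 := Real.rpow_pos_of_pos hr (p - 1)
    generalize (1 - ξ * t) ^ (1 - 2 * p) = v at *
    generalize (1 - ξ ^ 2) ^ (p - 1) = u at *
    norm_num
    field_simp
  · rw [← mul_assoc, ← Real.rpow_add hr]; simp

/-! ### The logarithmic potential of the arcsine law -/

/-- Writing `a = e^{iα}` with `cos α = ξ`, this is `|e^{iθ} - a| |e^{-iθ} - a| = 2 |cos α - cos θ|`.
-/
theorem norm_circleMap_sub_mul_norm {ξ θ : ℝ} (hξ : ξ ∈ Icc (-1) 1) :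
    ‖circleMap 0 1 θ - (⟨ξ, √(1 - ξ ^ 2)⟩ : ℂ)‖ *
      ‖circleMap 0 1 (2 * Real.pi - θ) - (⟨ξ, √(1 - ξ ^ 2)⟩ : ℂ)‖ = 2 * |ξ - Real.cos θ| := by
  have hσ : √(1 - ξ ^ 2) ^ 2 = 1 - ξ ^ 2 := Real.sq_sqrt (by nlinarith [hξ.1, hξ.2])
  generalize √(1 - ξ ^ 2) = σ at *
  have hcs := Real.sin_sq_add_cos_sq θ
  rw [← sq_eq_sq₀ (by positivity) (by positivity), mul_pow, Complex.sq_norm, Complex.sq_norm,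
    Complex.normSq_apply, Complex.normSq_apply, mul_pow, sq_abs]
  simp only [circleMap, zero_add, Complex.ofReal_one, one_mul, Complex.sub_re, Complex.sub_im,
    Complex.exp_ofReal_mul_I_re, Complex.exp_ofReal_mul_I_im, Real.cos_two_pi_sub,
    Real.sin_two_pi_sub]
  have hs : Real.sin θ ^ 2 = 1 - Real.cos θ ^ 2 := by linarith
  generalize Real.sin θ = s at *
  generalize Real.cos θ = c at *
  have e1 : (c - ξ) * (c - ξ) + (s - σ) * (s - σ) = 2 - 2 * c * ξ - 2 * s * σ := by
    linear_combination hcs + hσ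
  have e2 : (c - ξ) * (c - ξ) + (-s - σ) * (-s - σ) = 2 - 2 * c * ξ + 2 * s * σ := by
    linear_combination hcs + hσ
  rw [e1, e2]
  linear_combination (-4 * σ ^ 2) * hs - 4 * (1 - c ^ 2) * hσ

/-- The mean of `log |z - a|` over the unit circle is `0` for `|a| ≤ 1`. Folding the lower half
circle onto the upper one gives the integral of `log 2 + log |ξ - cos θ|` over `(0, π)`. -/
theorem hasIntegralOn_log_sub_cos {ξ : ℝ} (hξ : ξ ∈ Icc (-1) 1) :
    HasIntegralOn (fun θ => Real.log |ξ - Real.cos θ|) (Ioo 0 Real.pi)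
      (-(Real.pi * Real.log 2)) := by
  set a : ℂ := ⟨ξ, √(1 - ξ ^ 2)⟩ with ha
  set g : ℝ → ℝ := fun θ => Real.log ‖circleMap 0 1 θ - a‖ with hg
  have ha1 : ‖a‖ ≤ 1 := by
    rw [← sq_le_one_iff₀ (norm_nonneg _), Complex.sq_norm, Complex.normSq_apply]
    have hσ : √(1 - ξ ^ 2) ^ 2 = 1 - ξ ^ 2 := Real.sq_sqrt (by nlinarith [hξ.1, hξ.2])
    simp only [ha]
    nlinarith
  have hint : IntervalIntegrable g volume 0 (2 * Real.pi) :=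
    circleIntegrable_log_norm_sub_const (c := 0) (a := a) 1
  have hval : ∫ θ in (0 : ℝ)..2 * Real.pi, g θ = 0 := by
    have h := circleAverage_log_norm_sub_const_of_mem_closedBall (c := 0) (R := 1) (a := a)
      (by simpa using ha1)
    rw [Real.circleAverage, Real.log_one, smul_eq_mul, mul_eq_zero] at h
    exact h.resolve_left (by positivity)
  have hpi := Real.pi_pos
  have h1 : IntervalIntegrable g volume 0 Real.pi :=
    hint.mono_set (by
      rw [uIcc_of_le hpi.le, uIcc_of_le (by linarith)]; exact Icc_subset_Icc le_rfl (by linarith))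
  have h2 : IntervalIntegrable g volume Real.pi (2 * Real.pi) :=
    hint.mono_set (by
      rw [uIcc_of_le (by linarith), uIcc_of_le (by linarith)]
      exact Icc_subset_Icc hpi.le le_rfl)
  have h3 : IntervalIntegrable (fun θ => g (2 * Real.pi - θ)) volume 0 Real.pi := by
    have := (h2.comp_sub_left (2 * Real.pi)).symm
    ring_nf at this ⊢
    exact this
  have h4 : ∫ θ in (0 : ℝ)..Real.pi, g (2 * Real.pi - θ) = ∫ θ in Real.pi..2 * Real.pi, g θ := by
    rw [intervalIntegral.integral_comp_sub_left]; ring_nf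
  have hsum : HasIntegralOn (fun θ => g θ + g (2 * Real.pi - θ)) (Ioo 0 Real.pi) 0 := by
    refine ⟨(intervalIntegrable_iff_integrableOn_Ioo_of_le hpi.le).1 (h1.add h3), ?_⟩
    rw [← integral_Ioc_eq_integral_Ioo, ← intervalIntegral.integral_of_le hpi.le,
      intervalIntegral.integral_add h1 h3, h4,
      intervalIntegral.integral_add_adjacent_intervals h1 h2, hval]
  have hc : HasIntegralOn (fun _ => Real.log 2) (Ioo 0 Real.pi) (Real.pi * Real.log 2) :=
    ⟨integrableOn_const (by simp), by simp [hpi.le]⟩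
  have hdiff := hsum.sub hc
  have hae : (fun θ => g θ + g (2 * Real.pi - θ) - Real.log 2) =ᵐ[volume.restrict (Ioo 0 Real.pi)]
      fun θ => Real.log |ξ - Real.cos θ| := by
    -- At `θ = arccos ξ` the product of norms vanishes, and the logarithm of a product is not the
    -- sum of logarithms there because `log 0 = 0`.
    have hne : ∀ᵐ θ ∂(volume.restrict (Ioo 0 Real.pi)), θ ≠ Real.arccos ξ :=
      ae_restrict_of_ae (Measure.ae_ne volume _)
    filter_upwards [ae_restrict_mem measurableSet_Ioo, hne] with θ hθ hθ'
    have hcos : ξ - Real.cos θ ≠ 0 := fun h => hθ' (by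
      rw [sub_eq_zero.1 h, Real.arccos_cos hθ.1.le hθ.2.le])
    have hprod := norm_circleMap_sub_mul_norm (θ := θ) hξ
    rw [← ha] at hprod
    have hne2 : ‖circleMap 0 1 θ - a‖ * ‖circleMap 0 1 (2 * Real.pi - θ) - a‖ ≠ 0 := by
      rw [hprod]; positivity
    simp only [hg]
    rw [← Real.log_mul (left_ne_zero_of_mul hne2) (right_ne_zero_of_mul hne2), hprod,
      Real.log_mul two_ne_zero (abs_ne_zero.2 hcos)]
    ring
  exact ⟨hdiff.1.congr hae, by rw [← integral_congr_ae hae, hdiff.2]; ring⟩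

/-- The logarithmic potential of the arcsine weight is constant on the interval. -/
theorem hasIntegralOn_log_arcsine {ξ : ℝ} (hξ : ξ ∈ Icc (-1) 1) :
    HasIntegralOn (fun s => Real.log |ξ - s| * (1 - s ^ 2) ^ ((1 : ℝ) / 2 - 1)) (Ioo (-1) 1)
      (-(Real.pi * Real.log 2)) := by
  have him : Real.cos '' Ioo 0 Real.pi = Ioo (-1) 1 := by
    ext y
    constructor
    · rintro ⟨x, ⟨h1, h2⟩, rfl⟩
      have hs := Real.sin_pos_of_pos_of_lt_pi h1 h2
      have := Real.sin_sq_add_cos_sq x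
      constructor <;> nlinarith
    · rintro ⟨h1, h2⟩
      refine ⟨Real.arccos y, ⟨Real.arccos_pos.2 h2, lt_of_le_of_ne (Real.arccos_le_pi y) ?_⟩,
        Real.cos_arccos h1.le h2.le⟩
      rw [Ne, Real.arccos_eq_pi]; linarith
  rw [← him, HasIntegralOn.image_iff (φ' := fun θ => -Real.sin θ) measurableSet_Ioo
    (fun x _ => Real.hasDerivAt_cos x)
    (Real.injOn_cos.mono Ioo_subset_Icc_self)]
  refine (hasIntegralOn_log_sub_cos hξ).congr measurableSet_Ioo (fun θ ⟨h1, h2⟩ => ?_) rfl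
  have hs := Real.sin_pos_of_pos_of_lt_pi h1 h2
  rw [abs_neg, abs_of_pos hs, ← Real.sin_sq, ← Real.rpow_natCast (Real.sin θ) 2,
    ← Real.rpow_mul hs.le]
  norm_num
  rw [Real.rpow_neg_one]
  field_simp

/-! ### The kernel, uniformly in `k` -/

/-- The real-valued repulsion kernel, with a junk value at the origin for `k ≤ 0`. -/
noncomputable def rieszReal (k x : ℝ) : ℝ :=
  if k = 0 then Real.log |x| else Real.sign k * |x| ^ k

/-- `1` in the logarithmic case and `0` otherwise. -/
noncomputable def logDefect (k : ℝ) : ℝ := if k = 0 then 1 else 0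

/-- The normalising constant of the wall density, in both cases. -/
noncomputable def wallConst (k : ℝ) : ℝ := if k = 0 then Real.pi else |k| * wallC k

theorem rieszReal_neg (k x : ℝ) : rieszReal k (-x) = rieszReal k x := by
  simp [rieszReal]

theorem rieszReal_abs (k x : ℝ) : rieszReal k |x| = rieszReal k x := by
  simp [rieszReal]

theorem measurable_rieszReal (k : ℝ) : Measurable (rieszReal k) := by
  unfold rieszReal
  split_ifs
  · fun_prop
  · fun_prop

theorem sign_mul_self_eq_abs (k : ℝ) : Real.sign k * k = |k| := by
  rcases lt_trichotomy k 0 with h | rfl | h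
  · rw [Real.sign_of_neg h, abs_of_neg h]; ring
  · simp
  · rw [Real.sign_of_pos h, abs_of_pos h]; ring

theorem sign_mul_sign_of_ne_zero {k : ℝ} (hk : k ≠ 0) : Real.sign k * Real.sign k = 1 := by
  rcases Real.sign_apply_eq_of_ne_zero k hk with h | h <;> rw [h] <;> norm_num

/-- The factor in the derivative of the kernel, `V_k' (x) = slopeConst k * x ^ (k - 1)` for `x > 0`. -/
noncomputable def slopeConst (k : ℝ) : ℝ := if k = 0 then 1 else |k|

theorem slopeConst_pos (k : ℝ) : 0 < slopeConst k := by
  unfold slopeConst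
  split_ifs with h
  · norm_num
  · exact abs_pos.2 h

theorem hasDerivAt_rieszReal_of_pos {k x : ℝ} (hx : 0 < x) :
    HasDerivAt (rieszReal k) (slopeConst k * x ^ (k - 1)) x := by
  unfold slopeConst
  split_ifs with h
  · subst h
    rw [zero_sub, Real.rpow_neg_one, one_mul]
    refine (Real.hasDerivAt_log hx.ne').congr_of_eventuallyEq ?_
    filter_upwards with y
    simp [rieszReal]
  · have h1 := (Real.hasDerivAt_rpow_const (x := x) (p := k) (Or.inl hx.ne')).const_mul (Real.sign k)
    rw [← sign_mul_self_eq_abs, mul_assoc]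
    refine h1.congr_of_eventuallyEq ?_
    filter_upwards [lt_mem_nhds hx] with y hy
    simp [rieszReal, h, abs_of_pos hy]

theorem intervalIntegrable_rieszReal {k : ℝ} (hk : -1 < k) (a b : ℝ) :
    IntervalIntegrable (rieszReal k) volume a b := by
  refine intervalIntegrable_of_even (fun x => (rieszReal_neg k x).symm) (fun b hb => ?_)
    (by simp) (by simp)
  by_cases h : k = 0
  · subst h
    have : rieszReal 0 = Real.log := by ext x; simp [rieszReal]
    rw [this]
    exact intervalIntegral.intervalIntegrable_log'
  · refine ((intervalIntegral.intervalIntegrable_rpow' hk (a := 0) (b := b)).const_mul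
      (Real.sign k)).congr ?_
    intro x hx
    rw [uIoc_of_le hb.le] at hx
    simp [rieszReal, h, abs_of_pos hx.1]

/-- By homogeneity `x * V_k(x) / (1 + k)` is a primitive of `V_k` for `k ≠ 0`; the primitive of the
logarithm carries the extra term `-x`, which is what `logDefect` records. -/
theorem integral_rieszReal {k : ℝ} (hk : -1 < k) (a b : ℝ) :
    (1 + k) * ∫ y in a..b, rieszReal k y =
      b * rieszReal k b - a * rieszReal k a - logDefect k * (b - a) := by
  have key : ∀ b, 0 ≤ b → (1 + k) * ∫ y in (0 : ℝ)..b, rieszReal k y =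
      b * rieszReal k b - logDefect k * b := fun b hb => by
    by_cases h : k = 0
    · subst h
      have : rieszReal 0 = Real.log := by ext x; simp [rieszReal]
      rw [this, integral_log]
      simp [logDefect]
    · have : ∫ y in (0 : ℝ)..b, rieszReal k y = ∫ y in (0 : ℝ)..b, Real.sign k * y ^ k := by
        refine intervalIntegral.integral_congr fun x hx => ?_
        rw [uIcc_of_le hb] at hx
        simp [rieszReal, h, abs_of_nonneg hx.1]
      have h0 : k + 1 ≠ 0 := by linarith
      rw [this, intervalIntegral.integral_const_mul, integral_rpow (Or.inl hk)]
      simp only [logDefect, h, if_false, rieszReal, abs_of_nonneg hb]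
      rw [Real.zero_rpow h0, Real.rpow_add_one' hb h0, add_comm 1 k]
      field_simp
      ring
  have key2 : ∀ b, (1 + k) * ∫ y in (0 : ℝ)..b, rieszReal k y =
      b * rieszReal k b - logDefect k * b := fun b => by
    rcases le_total 0 b with hb | hb
    · exact key b hb
    · have h1 := intervalIntegral.integral_comp_neg (a := 0) (b := -b) (rieszReal k)
      simp only [rieszReal_neg, neg_neg, neg_zero] at h1
      rw [intervalIntegral.integral_symm, ← h1, mul_neg, key (-b) (by linarith), rieszReal_neg]
      ring
  have h2 := intervalIntegral.integral_add_adjacent_intervals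
    (intervalIntegrable_rieszReal hk a 0) (intervalIntegrable_rieszReal hk 0 b)
  rw [← h2, intervalIntegral.integral_symm 0 a, mul_add, mul_neg, key2, key2]
  ring

/-- Differences of points of `(-1, 1)` lie in `(-2, 2)`, so this is the integrand of a convolution
of two truncated integrable functions. It justifies Fubini in the recursion. -/
theorem integrable_prod_rieszReal {k : ℝ} (hk : -1 < k) {φ : ℝ → ℝ}
    (hφ : IntegrableOn φ (Ioo (-1) 1)) :
    Integrable (fun z : ℝ × ℝ => rieszReal k (z.1 - z.2) * φ z.2)
      ((volume.restrict (Ioo (-1) 1)).prod (volume.restrict (Ioo (-1) 1))) := by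
  have h1 : Integrable ((Ioo (-2 : ℝ) 2).indicator (rieszReal k)) :=
    ((intervalIntegrable_iff_integrableOn_Ioo_of_le (by norm_num)).1
      (intervalIntegrable_rieszReal hk (-2) 2)).integrable_indicator measurableSet_Ioo
  have h2 : Integrable ((Ioo (-1 : ℝ) 1).indicator φ) := hφ.integrable_indicator measurableSet_Ioo
  have h3 := (Integrable.convolution_integrand (ContinuousLinearMap.mul ℝ ℝ) h2 h1).restrict
    (s := Ioo (-1 : ℝ) 1 ×ˢ Ioo (-1 : ℝ) 1)
  rw [Measure.prod_restrict]
  refine h3.congr ?_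
  filter_upwards [ae_restrict_mem (measurableSet_Ioo.prod measurableSet_Ioo)] with z ⟨hz1, hz2⟩
  simp only [ContinuousLinearMap.mul_apply']
  rw [indicator_of_mem hz2, indicator_of_mem, mul_comm]
  exact ⟨by linarith [hz1.1, hz2.2], by linarith [hz1.2, hz2.1]⟩

/-! ### Potentials of the weight times `1`, `s` and `s ^ 2` -/

/-- The recursion between potentials of consecutive moments of a weight. -/
theorem potential_recursion {k : ℝ} (hk : -1 < k) {φ J J' : ℝ → ℝ} {m : ℝ}
    (hφ : HasIntegralOn φ (Ioo (-1) 1) m)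
    (hJ : ∀ ξ ∈ Icc (-1 : ℝ) 1, HasIntegralOn (fun s => rieszReal k (ξ - s) * φ s) (Ioo (-1) 1) (J ξ))
    (hJ' : ∀ ξ ∈ Icc (-1 : ℝ) 1,
      HasIntegralOn (fun s => rieszReal k (ξ - s) * (s * φ s)) (Ioo (-1) 1) (J' ξ))
    {ξ : ℝ} (hξ : ξ ∈ Icc (-1 : ℝ) 1) :
    J' ξ = ξ * J ξ + J' 0 - logDefect k * ξ * m - (1 + k) * ∫ y in (0 : ℝ)..ξ, J y := by
  have h0 : (0 : ℝ) ∈ Icc (-1 : ℝ) 1 := by norm_num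
  have hmem : ∀ y ∈ uIoc 0 ξ, y ∈ Icc (-1 : ℝ) 1 := fun y hy => by
    have := uIoc_subset_uIcc hy
    exact (uIcc_subset_Icc h0 hξ) this
  -- Integrate `J` from `0` to `ξ` and exchange the integrals; the primitive of the kernel brings
  -- out `(ξ - s) * V_k(ξ - s)`, whose `s`-part is the potential `J'` of the next moment.
  have e1 : ∫ y in (0 : ℝ)..ξ, J y =
      ∫ y in (0 : ℝ)..ξ, ∫ s in Ioo (-1) 1, rieszReal k (y - s) * φ s := by
    refine intervalIntegral.integral_congr_ae (Filter.Eventually.of_forall fun y hy => ?_)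
    exact (hJ y (hmem y hy)).2.symm
  have e2 : ∫ y in (0 : ℝ)..ξ, ∫ s in Ioo (-1) 1, rieszReal k (y - s) * φ s =
      ∫ s in Ioo (-1) 1, ∫ y in (0 : ℝ)..ξ, rieszReal k (y - s) * φ s := by
    refine intervalIntegral_integral_swap ?_
    refine (integrable_prod_rieszReal hk hφ.1).mono_measure (Measure.prod_mono ?_ le_rfl)
    rw [Measure.restrict_congr_set Ioo_ae_eq_Ioc]
    exact Measure.restrict_mono (Ioc_subset_Ioc (le_min (by norm_num) hξ.1)
      (max_le (by norm_num) hξ.2)) le_rfl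
  have e3 : ∀ s, (1 + k) * ∫ y in (0 : ℝ)..ξ, rieszReal k (y - s) * φ s =
      ξ * (rieszReal k (ξ - s) * φ s) - rieszReal k (ξ - s) * (s * φ s) +
        rieszReal k (0 - s) * (s * φ s) - logDefect k * ξ * φ s := fun s => by
    rw [intervalIntegral.integral_mul_const, intervalIntegral.integral_comp_sub_right, ← mul_assoc,
      integral_rieszReal hk]
    ring
  have e4 := ((((hJ ξ hξ).const_mul ξ).sub (hJ' ξ hξ)).add (hJ' 0 h0)).sub
    (hφ.const_mul (logDefect k * ξ))
  have e5 := e4.2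
  simp only [← e3] at e5
  rw [integral_const_mul, ← e2, ← e1] at e5
  linarith

/-- The value of the potential of the weight `(1 - s ^ 2) ^ ((1 - k) / 2 - 1)`. -/
noncomputable def potentialConst (k : ℝ) : ℝ :=
  if k = 0 then -(Real.pi * Real.log 2)
  else Real.sign k * (Real.pi / Real.sin (Real.pi * ((1 - k) / 2)))

theorem half_one_sub_mem {k : ℝ} (hk : k ∈ Ioo (-1 : ℝ) 1) : (1 - k) / 2 ∈ Ioo (0 : ℝ) 1 :=
  ⟨by linarith [hk.2], by linarith [hk.1]⟩

theorem gegenbauerMass_half : gegenbauerMass (1 / 2) = Real.pi := by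
  rw [gegenbauerMass_eq (by norm_num), Real.Gamma_one_half_eq]
  norm_num
  exact Real.mul_self_sqrt Real.pi_pos.le

/-- The combination in which the constant comes out of the recursion: the potential carries it for
`k ≠ 0`, the mass for `k = 0`. -/
theorem wallConst_eq {k : ℝ} : wallConst k =
    (1 - k) * (k * potentialConst k + logDefect k * gegenbauerMass ((1 - k) / 2)) := by
  unfold wallConst potentialConst logDefect
  split_ifs with h
  · subst h
    simp only [sub_zero, gegenbauerMass_half]
    ring
  · rw [← sign_mul_self_eq_abs, wallC, show (1 - k) * Real.pi / 2 = Real.pi * ((1 - k) / 2) by ring]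
    ring

theorem wallConst_pos {k : ℝ} (hk : k ∈ Ioo (-1 : ℝ) 1) : 0 < wallConst k := by
  unfold wallConst
  split_ifs with h
  · exact Real.pi_pos
  · refine mul_pos (abs_pos.2 h) (div_pos (mul_pos Real.pi_pos (by linarith [hk.2])) ?_)
    have := Real.pi_pos
    exact Real.sin_pos_of_pos_of_lt_pi (by nlinarith [hk.2]) (by nlinarith [hk.1])

theorem hasIntegralOn_potential_zero {k ξ : ℝ} (hk : k ∈ Ioo (-1 : ℝ) 1)
    (hξ : ξ ∈ Icc (-1 : ℝ) 1) :
    HasIntegralOn (fun s => rieszReal k (ξ - s) * (1 - s ^ 2) ^ ((1 - k) / 2 - 1)) (Ioo (-1) 1)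
      (potentialConst k) := by
  by_cases h : k = 0
  · subst h
    simpa [rieszReal, potentialConst] using hasIntegralOn_log_arcsine hξ
  · refine ((hasIntegralOn_riesz_gegenbauer (half_one_sub_mem hk) hξ).const_mul
      (Real.sign k)).congr measurableSet_Ioo (fun s _ => ?_) ?_
    · simp only [rieszReal, h, if_false]
      rw [show 1 - 2 * ((1 - k) / 2) = k by ring]; ring
    · simp [potentialConst, h]

theorem integrableOn_potential {k ξ : ℝ} (hk : k ∈ Ioo (-1 : ℝ) 1)
    (hξ : ξ ∈ Icc (-1 : ℝ) 1) (n : ℕ) :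
    IntegrableOn (fun s => rieszReal k (ξ - s) * (s ^ n * (1 - s ^ 2) ^ ((1 - k) / 2 - 1)))
      (Ioo (-1) 1) := by
  have := IntegrableOn.pow_mul_Ioo (hasIntegralOn_potential_zero hk hξ).1 n
  refine this.congr_fun (fun s _ => ?_) measurableSet_Ioo
  simp only
  ring

/-- The recursion applied to a constant potential gives a linear one, with no constant term by
parity. -/
theorem hasIntegralOn_potential_one {k ξ : ℝ} (hk : k ∈ Ioo (-1 : ℝ) 1)
    (hξ : ξ ∈ Icc (-1 : ℝ) 1) :
    HasIntegralOn (fun s => rieszReal k (ξ - s) * (s * (1 - s ^ 2) ^ ((1 - k) / 2 - 1)))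
      (Ioo (-1) 1) (-(wallConst k / (1 - k)) * ξ) := by
  have hint : ∀ ξ ∈ Icc (-1 : ℝ) 1, IntegrableOn (fun s => rieszReal k (ξ - s) *
      (s * (1 - s ^ 2) ^ ((1 - k) / 2 - 1))) (Ioo (-1) 1) := fun ξ hξ => by
    simpa using integrableOn_potential hk hξ 1
  have hrec := potential_recursion hk.1 (hasIntegralOn_gegenbauer (half_one_sub_mem hk).1)
    (fun ξ hξ => hasIntegralOn_potential_zero hk hξ) (fun ξ hξ => ⟨hint ξ hξ, rfl⟩) hξ
  have h0 := hasIntegralOn_of_odd (hint 0 (by norm_num)) (fun x => by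
    rw [show 0 - -x = -(0 - x) by ring, rieszReal_neg, neg_sq]; ring)
  refine ⟨hint ξ hξ, ?_⟩
  rw [hrec, h0.2, intervalIntegral.integral_const, smul_eq_mul, wallConst_eq]
  have : 1 - k ≠ 0 := by linarith [hk.2]
  field_simp
  ring

/-- The recursion applied to a linear potential gives a quadratic one. Its value at `0` is left
unevaluated, since it only enters the constant `S`. -/
theorem hasIntegralOn_potential_two {k ξ : ℝ} (hk : k ∈ Ioo (-1 : ℝ) 1)
    (hξ : ξ ∈ Icc (-1 : ℝ) 1) :
    HasIntegralOn (fun s => rieszReal k (ξ - s) * (s ^ 2 * (1 - s ^ 2) ^ ((1 - k) / 2 - 1)))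
      (Ioo (-1) 1) ((∫ s in Ioo (-1) 1, rieszReal k (0 - s) *
        (s ^ 2 * (1 - s ^ 2) ^ ((1 - k) / 2 - 1))) - wallConst k / 2 * ξ ^ 2) := by
  have hm := hasIntegralOn_gegenbauer_odd (half_one_sub_mem hk).1 (n := 1) odd_one
  simp only [pow_one] at hm
  have hint := fun ξ hξ => integrableOn_potential (ξ := ξ) hk hξ 2
  have hrec := potential_recursion hk.1 hm
    (fun ξ hξ => hasIntegralOn_potential_one hk hξ)
    (J' := fun ξ => ∫ s in Ioo (-1) 1, rieszReal k (ξ - s) *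
        (s ^ 2 * (1 - s ^ 2) ^ ((1 - k) / 2 - 1)))
    (fun ξ hξ => ⟨by simpa only [sq, mul_assoc] using hint ξ hξ, by simp only [sq, mul_assoc]⟩) hξ
  refine ⟨hint ξ hξ, ?_⟩
  rw [hrec, intervalIntegral.integral_const_mul, integral_id]
  have : 1 - k ≠ 0 := by linarith [hk.2]
  field_simp
  ring

/-! ### The candidate measure and its rescaling to `(-1, 1)` -/

/-- `f` is `μ`-integrable, with integral `I`. -/
def HasIntegralWrt (f : ℝ → ℝ) (μ : Measure ℝ) (I : ℝ) : Prop :=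
  Integrable f μ ∧ ∫ x, f x ∂μ = I

theorem HasIntegralOn.congr_ae {f g : ℝ → ℝ} {s : Set ℝ} {I J : ℝ} (hf : HasIntegralOn f s I)
    (h : f =ᵐ[volume.restrict s] g) (hI : I = J) : HasIntegralOn g s J :=
  ⟨hf.1.congr h, by rw [← integral_congr_ae h, hf.2, hI]⟩

theorem hasIntegralWrt_intervalMeasure {ω L I : ℝ} {g F : ℝ → ℝ} (hg : Measurable g)
    (hg0 : ∀ t ∈ Icc ω (ω + L), 0 ≤ g t)
    (h : HasIntegralOn (fun t => F t * g t) (Ioo ω (ω + L)) I) :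
    HasIntegralWrt F (intervalMeasure ω L g) I := by
  have hae : (fun t => F t * g t) =ᵐ[volume.restrict (Icc ω (ω + L))]
      fun t => (ENNReal.ofReal (g t)).toReal • F t := by
    filter_upwards [ae_restrict_mem measurableSet_Icc] with t ht
    rw [ENNReal.toReal_ofReal (hg0 t ht), smul_eq_mul, mul_comm]
  unfold HasIntegralOn IntegrableOn at h
  rw [Measure.restrict_congr_set Ioo_ae_eq_Icc] at h
  unfold HasIntegralWrt intervalMeasure
  rw [integrable_withDensity_iff_integrable_smul' hg.ennreal_ofReal (by simp),
    integral_withDensity_eq_integral_toReal_smul hg.ennreal_ofReal (by simp)]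
  exact ⟨h.1.congr hae, by rw [← integral_congr_ae hae, h.2]⟩

/-- The density of the constrained equilibrium measure, uniformly in `k`. -/
noncomputable def unifiedDensity (k ω L t : ℝ) : ℝ :=
  1 / wallConst k * (L + ω - t) ^ ((1 - k) / 2) * (t - ω) ^ (-((1 + k) / 2)) *
    (t - k * ω + (1 - k) / 2 * L)

theorem measurable_unifiedDensity (k ω L : ℝ) : Measurable (unifiedDensity k ω L) := by
  unfold unifiedDensity
  fun_prop

/-- The linear factor increases in `t` and equals `(1 - k) * (ω + L / 2)` at `t = ω`, so its sign is
decided by `-L ≤ 2 * ω`. -/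
theorem unifiedDensity_nonneg {k ω L : ℝ} (hk : k ∈ Ioo (-1 : ℝ) 1) (hω : -L ≤ 2 * ω) :
    ∀ t ∈ Icc ω (ω + L), 0 ≤ unifiedDensity k ω L t := by
  rintro t ⟨h1, h2⟩
  have hc := wallConst_pos hk
  have : 0 ≤ L + ω - t := by linarith
  have : 0 ≤ t - ω := by linarith
  have : 0 ≤ t - k * ω + (1 - k) / 2 * L := by nlinarith [hk.2]
  unfold unifiedDensity
  positivity

theorem unifiedDensity_pos {k ω L : ℝ} (hk : k ∈ Ioo (-1 : ℝ) 1) (hω : -L ≤ 2 * ω) :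
    ∀ t ∈ Ioo ω (ω + L), 0 < unifiedDensity k ω L t := by
  rintro t ⟨h1, h2⟩
  have hc := wallConst_pos hk
  have : 0 < L + ω - t := by linarith
  have : 0 < t - ω := by linarith
  have : 0 < t - k * ω + (1 - k) / 2 * L := by nlinarith [hk.2]
  unfold unifiedDensity
  positivity

/-- The constant term of the linear factor of the density in the rescaled variable. -/
noncomputable def wallOffset (k ω h : ℝ) : ℝ := (1 - k) * ω + (2 - k) * h

/-- Substitute `t = ω + h + h * s`. The two powers of the density and the Jacobian together
contribute `h ^ (1 - k)`. -/
theorem hasIntegralWrt_of_rescaled {k ω h I : ℝ} {F : ℝ → ℝ} (hk : k ∈ Ioo (-1 : ℝ) 1) (hh : 0 < h)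
    (hω : -h ≤ ω)
    (hF : HasIntegralOn (fun s => F (ω + h + h * s) * (h ^ (1 - k) / wallConst k *
      ((1 - s) ^ ((1 - k) / 2) * (1 + s) ^ ((1 - k) / 2 - 1) * (h * s + wallOffset k ω h))))
      (Ioo (-1) 1) I) :
    HasIntegralWrt F (intervalMeasure ω (2 * h) (unifiedDensity k ω (2 * h))) I := by
  refine hasIntegralWrt_intervalMeasure (measurable_unifiedDensity _ _ _)
    (unifiedDensity_nonneg hk (by linarith)) ?_
  have e : Ioo ω (ω + 2 * h) = Ioo (ω + h + h * (-1)) (ω + h + h * 1) := by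
    congr 1 <;> ring
  rw [e, ← HasIntegralOn.comp_affine_iff hh]
  refine hF.congr measurableSet_Ioo (fun s ⟨h1, h2⟩ => ?_) rfl
  unfold unifiedDensity wallOffset
  rw [show 2 * h + ω - (ω + h + h * s) = h * (1 - s) by ring,
    show ω + h + h * s - ω = h * (1 + s) by ring,
    show -((1 + k) / 2) = (1 - k) / 2 - 1 by ring,
    Real.mul_rpow hh.le (by linarith), Real.mul_rpow hh.le (by linarith),
    show 1 - k = (1 - k) / 2 + ((1 - k) / 2 - 1) + 1 by ring,
    Real.rpow_add_one hh.ne', Real.rpow_add hh,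
    show ((1 - k) / 2 + ((1 - k) / 2 - 1) + 1) = 1 - k by ring]
  ring

theorem one_sub_rpow_mul {p s : ℝ} (h1 : -1 < s) (h2 : s < 1) :
    (1 - s) ^ p * (1 + s) ^ (p - 1) = (1 - s) * (1 - s ^ 2) ^ (p - 1) := by
  rw [show 1 - s ^ 2 = (1 - s) * (1 + s) by ring, Real.mul_rpow (by linarith) (by linarith)]
  conv_lhs => rw [show p = (p - 1) + 1 by ring, Real.rpow_add_one (by linarith)]
  ring_nf

/-- Normalisation of the length of the support, in the half-length `h`. -/
def UnitMass (k ω h : ℝ) : Prop :=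
  h ^ (1 - k) * ((3 - k) * h + (2 - k) * ω) * gegenbauerMass ((1 - k) / 2) * (1 - k) =
    wallConst k * (2 - k)

/-! ### Mass, second moment and potential on the support -/

section moments

variable {k ω h : ℝ}

/-- Replaces the transcendental prefactor of all moments by a rational function of `k`, `ω` and `h`.
-/
theorem UnitMass.coeff_eq (hk : k ∈ Ioo (-1 : ℝ) 1) (hh : 0 < h) (hω : -h ≤ ω) (hm : UnitMass k ω h) :
    h ^ (1 - k) / wallConst k * gegenbauerMass ((1 - k) / 2) =
      (2 - k) / ((1 - k) * ((3 - k) * h + (2 - k) * ω)) := by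
  have hc := wallConst_pos hk
  have h1 : 0 < 1 - k := by linarith [hk.2]
  have h2 : 0 < (3 - k) * h + (2 - k) * ω := by nlinarith
  have h3 : (3 - k) * h + (2 - k) * ω ≠ 0 := h2.ne'
  unfold UnitMass at hm
  rw [div_mul_eq_mul_div, div_eq_div_iff hc.ne' (mul_pos h1 h2).ne']
  linarith

/-- The null summand keeps the shape produced by `hasIntegralOn_rescaled_even_moments` with `c₄ =
0`. -/
theorem UnitMass.mass_eq (hk : k ∈ Ioo (-1 : ℝ) 1) (hh : 0 < h) (hω : -h ≤ ω)
    (hm : UnitMass k ω h) : h ^ (1 - k) / wallConst k * (gegenbauerMass ((1 - k) / 2) *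
      (wallOffset k ω h + -h / (2 - k) + 0 * 3 / ((2 - k) * (4 - k)))) = 1 := by
  rw [← mul_assoc, hm.coeff_eq hk hh hω, wallOffset]
  have h1 : 1 - k ≠ 0 := by linarith [hk.2]
  have h4 : 2 - k ≠ 0 := by linarith [hk.2]
  have h2 : (3 - k) * h + (2 - k) * ω ≠ 0 := by nlinarith [hk.2]
  have h3 : h * (3 - k) + ω * (2 - k) ≠ 0 := by rwa [mul_comm h, mul_comm ω]
  field_simp
  ring

theorem hasIntegralOn_rescaled_even_moments (hk : k ∈ Ioo (-1 : ℝ) 1) (c₀ c₁ c₂ c₃ c₄ : ℝ) :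
    HasIntegralOn (fun s => (c₀ + c₁ * s + c₂ * s ^ 2 + c₃ * s ^ 3 + c₄ * s ^ 4) *
      (1 - s ^ 2) ^ ((1 - k) / 2 - 1)) (Ioo (-1) 1)
      (gegenbauerMass ((1 - k) / 2) * (c₀ + c₂ / (2 - k) + c₄ * 3 / ((2 - k) * (4 - k)))) := by
  have hp := (half_one_sub_mem hk).1
  refine (((((hasIntegralOn_gegenbauer hp).const_mul c₀).add
    ((hasIntegralOn_gegenbauer_odd hp (n := 1) (by decide)).const_mul c₁)).add
    ((hasIntegralOn_gegenbauer_two hp).const_mul c₂)).add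
    (((hasIntegralOn_gegenbauer_odd hp (n := 3) (by decide)).const_mul c₃))).add
    ((hasIntegralOn_gegenbauer_four hp).const_mul c₄) |>.congr measurableSet_Ioo
    (fun s _ => by ring) ?_
  rw [show 2 * ((1 - k) / 2) + 1 = 2 - k by ring, show 2 * ((1 - k) / 2) + 3 = 4 - k by ring]
  ring

theorem hasIntegralWrt_one (hk : k ∈ Ioo (-1 : ℝ) 1) (hh : 0 < h) (hω : -h ≤ ω)
    (hm : UnitMass k ω h) :
    HasIntegralWrt (fun _ => 1) (intervalMeasure ω (2 * h) (unifiedDensity k ω (2 * h))) 1 := by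
  refine hasIntegralWrt_of_rescaled hk hh hω ?_
  refine ((hasIntegralOn_rescaled_even_moments hk (wallOffset k ω h) (h - wallOffset k ω h) (-h) 0
    0).const_mul (h ^ (1 - k) / wallConst k)).congr measurableSet_Ioo (fun s ⟨h1, h2⟩ => ?_) ?_
  · rw [one_sub_rpow_mul h1 h2]; ring
  · exact hm.mass_eq hk hh hω

theorem hasIntegralWrt_sq (hk : k ∈ Ioo (-1 : ℝ) 1) (hh : 0 < h) (hω : -h ≤ ω)
    (hm : UnitMass k ω h) :
    HasIntegralWrt (fun x => x ^ 2) (intervalMeasure ω (2 * h) (unifiedDensity k ω (2 * h)))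
      ((2 - k) / ((1 - k) * ((3 - k) * h + (2 - k) * ω)) *
        ((ω + h) ^ 2 * wallOffset k ω h + (-(ω + h) ^ 2 * h + 2 * (ω + h) * h *
          (h - wallOffset k ω h) + h ^ 2 * wallOffset k ω h) / (2 - k) -
          h ^ 3 * 3 / ((2 - k) * (4 - k)))) := by
  refine hasIntegralWrt_of_rescaled hk hh hω ?_
  -- The coefficients are those of `(1 - s) * (h * s + A) * (ω + h + h * s) ^ 2`, where `A =
  -- wallOffset k ω h`.
  refine ((hasIntegralOn_rescaled_even_moments hk ((ω + h) ^ 2 * wallOffset k ω h)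
    ((ω + h) ^ 2 * (h - wallOffset k ω h) + 2 * (ω + h) * h * wallOffset k ω h)
    (-(ω + h) ^ 2 * h + 2 * (ω + h) * h * (h - wallOffset k ω h) + h ^ 2 * wallOffset k ω h)
    (-2 * (ω + h) * h ^ 2 + h ^ 2 * (h - wallOffset k ω h))
    (-h ^ 3)).const_mul (h ^ (1 - k) / wallConst k)).congr measurableSet_Ioo
      (fun s ⟨h1, h2⟩ => ?_) ?_
  · rw [one_sub_rpow_mul h1 h2]; ring
  · rw [← mul_assoc, hm.coeff_eq hk hh hω]
    ring

theorem rieszReal_mul {y : ℝ} (hh : 0 < h) (hy : y ≠ 0) :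
    rieszReal k (h * y) = h ^ k * rieszReal k y + logDefect k * Real.log h := by
  unfold rieszReal logDefect
  split_ifs with h0
  · rw [h0, abs_mul, abs_of_pos hh, Real.log_mul hh.ne' (abs_ne_zero.2 hy)]
    simp; ring
  · rw [abs_mul, abs_of_pos hh, Real.mul_rpow hh.le (abs_nonneg _)]; ring

/-- On its support, the potential of the measure is a quadratic polynomial. -/
theorem exists_hasIntegralWrt_potential (hk : k ∈ Ioo (-1 : ℝ) 1) (hh : 0 < h) (hω : -h ≤ ω)
    (hm : UnitMass k ω h) : ∃ S : ℝ, ∀ x ∈ Icc ω (ω + 2 * h),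
      HasIntegralWrt (fun y => rieszReal k (x - y))
        (intervalMeasure ω (2 * h) (unifiedDensity k ω (2 * h))) (1 / 2 * x ^ 2 - S) := by
  set J := ∫ s in Ioo (-1) 1, rieszReal k (0 - s) *
        (s ^ 2 * (1 - s ^ 2) ^ ((1 - k) / 2 - 1)) with hJ
  set c := wallConst k with hc
  set A := wallOffset k ω h with hA
  have hc0 : 0 < c := wallConst_pos hk
  refine ⟨1 / 2 * (ω + h) ^ 2 - h / c * (A * potentialConst k - h * J) -
    logDefect k * Real.log h, fun x hx => hasIntegralWrt_of_rescaled hk hh hω ?_⟩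
  obtain ⟨ξ, rfl⟩ : ∃ ξ, x = ω + h + h * ξ := ⟨(x - (ω + h)) / h, by field_simp; ring⟩
  have hξ : ξ ∈ Icc (-1 : ℝ) 1 := by
    constructor
    · nlinarith [hx.1]
    · nlinarith [hx.2]
  -- The logarithm is not homogeneous: scaling by `h` adds `log h` times the total mass, which is
  -- `1`.
  have hmass := (hasIntegralOn_rescaled_even_moments hk A (h - A) (-h) 0 0).const_mul
    (h ^ (1 - k) / c * logDefect k * Real.log h)
  -- Expands `(1 - s) * (h * s + A) = A + (h - A) * s - h * s ^ 2`.
  have hpot := ((((hasIntegralOn_potential_zero hk hξ).const_mul A).add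
    ((hasIntegralOn_potential_one hk hξ).const_mul (h - A))).sub
    ((hasIntegralOn_potential_two hk hξ).const_mul h)).const_mul (h / c)
  refine (hpot.add hmass).congr_ae ?_ ?_
  · filter_upwards [ae_restrict_mem measurableSet_Ioo, ae_restrict_of_ae (Measure.ae_ne volume ξ)]
      with s ⟨h1, h2⟩ hs
    rw [one_sub_rpow_mul h1 h2, show ω + h + h * ξ - (ω + h + h * s) = h * (ξ - s) by ring,
      rieszReal_mul hh (sub_ne_zero.2 (Ne.symm hs))]
    have : h ^ k * h ^ (1 - k) = h := by rw [← Real.rpow_add hh]; simp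
    generalize h ^ (1 - k) = a at *
    generalize h ^ k = b at *
    generalize (1 - s ^ 2) ^ ((1 - k) / 2 - 1) = φ
    linear_combination (-(1 / c) * rieszReal k (ξ - s) * φ * ((1 - s) * (h * s + A))) * this
  · have h1 := hm.mass_eq hk hh hω
    -- The choice of `A` gives `h - A = -(1 - k) * (ω + h)`, exactly what the coefficient `h * (ω +
    -- h)` of `ξ` in `x ^ 2 / 2` requires.
    have h2 : (h - A) * (c / (1 - k)) = -(c * (ω + h)) := by
      have : 1 - k ≠ 0 := by linarith [hk.2]
      rw [hA, wallOffset]; field_simp; ring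
    rw [← hc, ← hA] at h1
    have h3 : h / c * c = h := by field_simp
    linear_combination (logDefect k * Real.log h) * h1 - (h / c * ξ) * h2 +
      ((ω + h) * ξ + h / 2 * ξ ^ 2) * h3

/-! ### The right endpoint and beyond -/

/-- The slope of the potential at the right endpoint. -/
theorem hasIntegralWrt_slope (hk : k ∈ Ioo (-1 : ℝ) 1) (hh : 0 < h) (hω : -h ≤ ω) :
    HasIntegralWrt (fun y => slopeConst k * (ω + 2 * h - y) ^ (k - 1))
      (intervalMeasure ω (2 * h) (unifiedDensity k ω (2 * h))) (ω + 2 * h) := by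
  refine hasIntegralWrt_of_rescaled hk hh hω ?_
  obtain ⟨hp0, hp1⟩ := half_one_sub_mem hk
  have h0 := hasIntegralOn_beta_symm (sub_pos.2 hp1) hp0
  have h1 := hasIntegralOn_beta_symm (sub_pos.2 hp1) (by linarith : 0 < (1 - k) / 2 + 1)
  -- Writing `h * s + A = (A - h) + h * (1 + s)` leaves two beta integrals.
  refine ((h0.const_mul (wallOffset k ω h - h)).add (h1.const_mul h)).const_mul
    (slopeConst k / wallConst k) |>.congr measurableSet_Ioo (fun s ⟨hs1, hs2⟩ => ?_) ?_
  · have u : 0 < 1 - s := by linarith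
    have v : 0 < 1 + s := by linarith
    rw [show ω + 2 * h - (ω + h + h * s) = h * (1 - s) by ring, Real.mul_rpow hh.le u.le,
      add_sub_cancel_right, show (1 - k) / 2 = ((1 - k) / 2 - 1) + 1 by ring,
      Real.rpow_add_one v.ne', add_sub_cancel_right]
    have e1 : h ^ (k - 1) * h ^ (1 - k) = 1 := by rw [← Real.rpow_add hh]; simp
    have e2 : (1 - s) ^ (k - 1) * (1 - s) ^ ((1 - k) / 2 - 1 + 1) =
        (1 - s) ^ (1 - ((1 - k) / 2 - 1 + 1) - 1) := by
      rw [← Real.rpow_add u]; congr 1; ring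
    rw [← e2]
    linear_combination (-slopeConst k / wallConst k * (1 - s) ^ (k - 1) *
      (1 - s) ^ ((1 - k) / 2 - 1 + 1) * (1 + s) ^ ((1 - k) / 2 - 1) * (h * s + wallOffset k ω h)) * e1
  -- The reflection formula for Gamma produces the sine of `wallC`, which cancels.
  · have hB : slopeConst k / wallConst k * ProbabilityTheory.beta (1 - (1 - k) / 2) ((1 - k) / 2) *
        (1 - k) = 1 := by
      rw [beta_one_sub', wallConst, slopeConst]
      have hpi := Real.pi_pos
      have h1k : 1 - k ≠ 0 := by linarith [hk.2]
      split_ifs with hk0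
      · subst hk0
        rw [show Real.pi * ((1 - 0) / 2) = Real.pi / 2 by ring, Real.sin_pi_div_two]
        field_simp
        norm_num
      · have hs : Real.sin (Real.pi * ((1 - k) / 2)) ≠ 0 :=
          (Real.sin_pos_of_pos_of_lt_pi (by positivity) (by nlinarith)).ne'
        have := abs_pos.2 hk0
        rw [wallC, show (1 - k) * Real.pi / 2 = Real.pi * ((1 - k) / 2) by ring]
        generalize Real.sin (Real.pi * ((1 - k) / 2)) = σ at *
        field_simp
    have hB2 : ProbabilityTheory.beta (1 - (1 - k) / 2) ((1 - k) / 2 + 1) =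
        (1 - k) / 2 * ProbabilityTheory.beta (1 - (1 - k) / 2) ((1 - k) / 2) := by
      unfold ProbabilityTheory.beta
      rw [Real.Gamma_add_one hp0.ne',
        show 1 - (1 - k) / 2 + ((1 - k) / 2 + 1) = 1 + 1 by ring, Real.Gamma_add_one one_ne_zero,
        show 1 - (1 - k) / 2 + (1 - k) / 2 = 1 by ring]
      simp; ring
    rw [hB2, show 1 - (1 - k) / 2 + (1 - k) / 2 - 1 = 0 by ring,
      show 1 - (1 - k) / 2 + ((1 - k) / 2 + 1) - 1 = 1 by ring, Real.rpow_zero, Real.rpow_one,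
      wallOffset]
    linear_combination (ω + 2 * h) * hB

/-- The potential at the right endpoint, for a power kernel. -/
theorem hasIntegralWrt_potential_right (hk : k ∈ Ioo (-1 : ℝ) 1) (hk0 : k ≠ 0) (hh : 0 < h)
    (hω : -h ≤ ω) :
    HasIntegralWrt (fun y => rieszReal k (ω + 2 * h - y))
      (intervalMeasure ω (2 * h) (unifiedDensity k ω (2 * h)))
      ((1 + k) / k * h * (ω + 3 / 2 * h)) := by
  refine hasIntegralWrt_of_rescaled hk hh hω ?_
  obtain ⟨hp0, hp1⟩ := half_one_sub_mem hk
  have h0 := hasIntegralOn_beta_symm (by linarith : 0 < 1 - (1 - k) / 2 + 1) hp0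
  have h1 := hasIntegralOn_beta_symm (by linarith : 0 < 1 - (1 - k) / 2 + 1 + 1) hp0
  -- Here `h * s + A = (A + h) - h * (1 - s)`, since the kernel contributes powers of `1 - s`.
  refine ((h0.const_mul (wallOffset k ω h + h)).sub (h1.const_mul h)).const_mul
    (Real.sign k * h / wallConst k) |>.congr measurableSet_Ioo (fun s ⟨hs1, hs2⟩ => ?_) ?_
  · have u : 0 < 1 - s := by linarith
    have v : 0 < 1 + s := by linarith
    rw [show ω + 2 * h - (ω + h + h * s) = h * (1 - s) by ring, rieszReal_mul hh u.ne',
      add_sub_cancel_right, add_sub_cancel_right, Real.rpow_add_one u.ne']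
    simp only [rieszReal, logDefect, hk0, if_false, zero_mul, add_zero, abs_of_pos u]
    have e1 : h ^ k * h ^ (1 - k) = h := by rw [← Real.rpow_add hh]; simp
    have e2 : (1 - s) ^ k * (1 - s) ^ ((1 - k) / 2) = (1 - s) ^ (1 - (1 - k) / 2) := by
      rw [← Real.rpow_add u]; congr 1; ring
    rw [← e2]
    linear_combination (-Real.sign k / wallConst k * (1 - s) ^ k * (1 - s) ^ ((1 - k) / 2) *
      (1 + s) ^ ((1 - k) / 2 - 1) * (h * s + wallOffset k ω h)) * e1
  · have hB : Real.sign k / wallConst k *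
        ProbabilityTheory.beta (1 - (1 - k) / 2) ((1 - k) / 2) * (1 - k) * k = 1 := by
      rw [beta_one_sub', wallConst, if_neg hk0]
      have hpi := Real.pi_pos
      have h1k : 1 - k ≠ 0 := by linarith [hk.2]
      have hs : Real.sin (Real.pi * ((1 - k) / 2)) ≠ 0 :=
        (Real.sin_pos_of_pos_of_lt_pi (by positivity) (by nlinarith)).ne'
      have h3 : Real.sign k ≠ 0 := fun h => hk0 (Real.sign_eq_zero_iff.1 h)
      rw [wallC, show (1 - k) * Real.pi / 2 = Real.pi * ((1 - k) / 2) by ring,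
        ← sign_mul_self_eq_abs]
      generalize Real.sin (Real.pi * ((1 - k) / 2)) = σ at *
      field_simp
    have hq : 0 < 1 - (1 - k) / 2 := by linarith
    have hB2 : ProbabilityTheory.beta (1 - (1 - k) / 2 + 1) ((1 - k) / 2) =
        (1 + k) / 2 * ProbabilityTheory.beta (1 - (1 - k) / 2) ((1 - k) / 2) := by
      unfold ProbabilityTheory.beta
      rw [Real.Gamma_add_one hq.ne',
        show 1 - (1 - k) / 2 + 1 + (1 - k) / 2 = 1 + 1 by ring, Real.Gamma_add_one one_ne_zero,
        show 1 - (1 - k) / 2 + (1 - k) / 2 = 1 by ring]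
      simp; ring
    have hB3 : ProbabilityTheory.beta (1 - (1 - k) / 2 + 1 + 1) ((1 - k) / 2) =
        (1 + k) * (3 + k) / 8 * ProbabilityTheory.beta (1 - (1 - k) / 2) ((1 - k) / 2) := by
      unfold ProbabilityTheory.beta
      rw [Real.Gamma_add_one (by linarith : 1 - (1 - k) / 2 + 1 ≠ 0), Real.Gamma_add_one hq.ne',
        show 1 - (1 - k) / 2 + 1 + 1 + (1 - k) / 2 = 1 + 1 + 1 by ring,
        Real.Gamma_add_one (by norm_num : (1 : ℝ) + 1 ≠ 0), Real.Gamma_add_one one_ne_zero,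
        show 1 - (1 - k) / 2 + (1 - k) / 2 = 1 by ring]
      simp; ring
    rw [hB2, hB3, show 1 - (1 - k) / 2 + 1 + (1 - k) / 2 - 1 = 1 by ring,
      show 1 - (1 - k) / 2 + 1 + 1 + (1 - k) / 2 - 1 = 2 by ring, Real.rpow_one,
      Real.rpow_two, wallOffset]
    rw [← eq_div_iff hk0] at hB
    linear_combination ((1 + k) * h * (ω + 3 / 2 * h)) * hB

/-- On `(0, ∞)` the kernel is increasing and, because `k < 1`, its slope decreases; the mean value
theorem gives both bounds. -/
theorem rieszReal_tangent {u v : ℝ} (hk : k < 1) (hu : 0 < u) (huv : u ≤ v) :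
    rieszReal k u ≤ rieszReal k v ∧
      rieszReal k v ≤ rieszReal k u + slopeConst k * u ^ (k - 1) * (v - u) := by
  rcases huv.eq_or_lt with rfl | huv
  · simp
  obtain ⟨ξ, hξ, he⟩ := exists_hasDerivAt_eq_slope (rieszReal k) (fun x => slopeConst k * x ^ (k - 1))
    huv (fun x hx => (hasDerivAt_rieszReal_of_pos (hu.trans_le hx.1)).continuousAt.continuousWithinAt)
    (fun x hx => hasDerivAt_rieszReal_of_pos (hu.trans hx.1))
  have hvu : 0 < v - u := by linarith
  rw [eq_div_iff hvu.ne'] at he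
  have h1 : ξ ^ (k - 1) ≤ u ^ (k - 1) :=
    Real.rpow_le_rpow_of_nonpos hu hξ.1.le (by linarith)
  have hs := slopeConst_pos k
  have h2 : 0 < ξ ^ (k - 1) := Real.rpow_pos_of_pos (hu.trans hξ.1) _
  constructor
  · have : 0 < slopeConst k * ξ ^ (k - 1) * (v - u) := by positivity
    linarith
  · have : slopeConst k * ξ ^ (k - 1) * (v - u) ≤ slopeConst k * u ^ (k - 1) * (v - u) := by gcongr
    linarith

theorem ae_intervalMeasure {ω L : ℝ} {g : ℝ → ℝ} :
    ∀ᵐ y ∂(intervalMeasure ω L g), y ∈ Ioo ω (ω + L) := by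
  refine (withDensity_absolutelyContinuous _ _).ae_le ?_
  rw [← Measure.restrict_congr_set Ioo_ae_eq_Icc]
  exact ae_restrict_mem measurableSet_Ioo

/-- Beyond the right endpoint the potential lies below its tangent line. -/
theorem potential_outside (hk : k ∈ Ioo (-1 : ℝ) 1) (hh : 0 < h) (hω : -h ≤ ω) {U x : ℝ}
    (hU : HasIntegralWrt (fun y => rieszReal k (ω + 2 * h - y))
        (intervalMeasure ω (2 * h) (unifiedDensity k ω (2 * h))) U) (hx : ω + 2 * h ≤ x) :
    Integrable (fun y => rieszReal k (x - y))
      (intervalMeasure ω (2 * h) (unifiedDensity k ω (2 * h))) ∧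
    ∫ y, rieszReal k (x - y) ∂(intervalMeasure ω (2 * h) (unifiedDensity k ω (2 * h))) ≤
      U + (x - (ω + 2 * h)) * (ω + 2 * h) := by
  have hs := hasIntegralWrt_slope hk hh hω
  have hup := hU.1.add (hs.1.mul_const (x - (ω + 2 * h)))
  have hb : ∀ᵐ y ∂(intervalMeasure ω (2 * h) (unifiedDensity k ω (2 * h))),
      rieszReal k (ω + 2 * h - y) ≤ rieszReal k (x - y) ∧ rieszReal k (x - y) ≤
        rieszReal k (ω + 2 * h - y) +
          slopeConst k * (ω + 2 * h - y) ^ (k - 1) * (x - (ω + 2 * h)) := by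
    filter_upwards [ae_intervalMeasure] with y hy
    have := rieszReal_tangent (k := k) (u := ω + 2 * h - y) (v := x - y) hk.2 (by linarith [hy.2])
      (by linarith)
    rwa [show x - y - (ω + 2 * h - y) = x - (ω + 2 * h) by ring] at this
  have hint : Integrable (fun y => rieszReal k (x - y))
      (intervalMeasure ω (2 * h) (unifiedDensity k ω (2 * h))) := by
    refine (hU.1.abs.add hup.abs).mono'
      ((measurable_rieszReal k).comp (measurable_const.sub measurable_id)).aestronglyMeasurable ?_
    filter_upwards [hb] with y ⟨h1, h2⟩
    simp only [Pi.add_apply, Real.norm_eq_abs]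
    refine abs_le.2 ⟨?_, ?_⟩
    · linarith [neg_abs_le (rieszReal k (ω + 2 * h - y)), abs_nonneg (rieszReal k (ω + 2 * h - y) +
          slopeConst k * (ω + 2 * h - y) ^ (k - 1) * (x - (ω + 2 * h)))]
    · linarith [le_abs_self (rieszReal k (ω + 2 * h - y) +
          slopeConst k * (ω + 2 * h - y) ^ (k - 1) * (x - (ω + 2 * h))),
          abs_nonneg (rieszReal k (ω + 2 * h - y))]
  refine ⟨hint, ?_⟩
  have h1 : ∫ y, rieszReal k (x - y) ∂(intervalMeasure ω (2 * h) (unifiedDensity k ω (2 * h))) ≤ _ :=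
    integral_mono_ae hint hup (hb.mono fun y hy => hy.2)
  refine h1.trans_eq ?_
  simp only [Pi.add_apply]
  rw [integral_add hU.1 (hs.1.mul_const _), integral_mul_const, hU.2, hs.2]
  ring

theorem isProbabilityMeasure_wall (hk : k ∈ Ioo (-1 : ℝ) 1) (hh : 0 < h) (hω : -h ≤ ω)
    (hm : UnitMass k ω h) :
    IsProbabilityMeasure (intervalMeasure ω (2 * h) (unifiedDensity k ω (2 * h))) := by
  have h1 := (hasIntegralWrt_one hk hh hω hm).2
  simp only [integral_const, smul_eq_mul, mul_one] at h1
  refine ⟨?_⟩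
  rw [measureReal_def, ENNReal.toReal_eq_one_iff] at h1
  exact h1

theorem support_intervalMeasure {ω L : ℝ} {g : ℝ → ℝ} (hL : 0 < L) (hg : Measurable g)
    (hpos : ∀ t ∈ Ioo ω (ω + L), 0 < g t) :
    (intervalMeasure ω L g).support = Icc ω (ω + L) := by
  refine (Measure.support_subset_of_isClosed isClosed_Icc ?_).antisymm ?_
  · exact ae_intervalMeasure.mono fun y hy => Ioo_subset_Icc_self hy
  · rw [← closure_Ioo (by linarith : ω ≠ ω + L)]
    refine closure_minimal (fun x hx => ?_) Measure.isClosed_support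
    rw [Measure.mem_support_iff_forall]
    intro U hU
    obtain ⟨V, hVU, hV, hxV⟩ := mem_nhds_iff.1 (Filter.inter_mem hU (isOpen_Ioo.mem_nhds hx))
    refine lt_of_lt_of_le ?_ (measure_mono (hVU.trans inter_subset_left))
    have hVI : V ⊆ Ioo ω (ω + L) := hVU.trans inter_subset_right
    rw [intervalMeasure, withDensity_apply _ hV.measurableSet, Measure.restrict_restrict
      hV.measurableSet, inter_eq_left.2 (hVI.trans Ioo_subset_Icc_self),
      setLIntegral_pos_iff hg.ennreal_ofReal]
    refine (hV.measure_pos volume ⟨x, hxV⟩).trans_le (measure_mono fun y hy => ⟨?_, hy⟩)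
    simpa using hpos y (hVI hy)

end moments

/-! ### Layer-cake representation of the kernel by tents -/

/-- The left end `a = 0` is admitted only for `k > 0`, where the kernel is finite at the origin and
its derivative integrable. -/
theorem integral_rpow_sub_one {k a b : ℝ} (hab : a ≤ b) (ha : 0 < a ∨ 0 ≤ a ∧ 0 < k) :
    HasIntegralOn (fun y => slopeConst k * y ^ (k - 1)) (Ioc a b)
      (rieszReal k b - rieszReal k a) := by
  have ha0 : 0 ≤ a := by rcases ha with h | h <;> linarith
  have key : IntervalIntegrable (fun y => slopeConst k * y ^ (k - 1)) volume a b ∧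
      ∫ y in a..b, slopeConst k * y ^ (k - 1) = rieszReal k b - rieszReal k a := by
    by_cases hk : 0 < k
    · have hi : IntervalIntegrable (fun y => slopeConst k * y ^ (k - 1)) volume a b :=
        (intervalIntegral.intervalIntegrable_rpow' (by linarith)).const_mul _
      refine ⟨hi, ?_⟩
      rw [intervalIntegral.integral_const_mul, integral_rpow (Or.inl (by linarith))]
      simp only [slopeConst, rieszReal, hk.ne', if_false, abs_of_nonneg ha0,
        abs_of_nonneg (ha0.trans hab), abs_of_pos hk, Real.sign_of_pos hk, sub_add_cancel]
      field_simp
    · have ha' : 0 < a := ha.resolve_right fun h => hk h.2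
      have hpos : ∀ x ∈ uIcc a b, 0 < x := fun x hx => by
        rw [uIcc_of_le hab] at hx; exact ha'.trans_le hx.1
      have hi : IntervalIntegrable (fun y => slopeConst k * y ^ (k - 1)) volume a b := by
        refine ContinuousOn.intervalIntegrable fun x hx => ?_
        exact ((Real.continuousAt_rpow_const x _ (Or.inl (hpos x hx).ne')).const_mul
          _).continuousWithinAt
      exact ⟨hi, intervalIntegral.integral_eq_sub_of_hasDerivAt
        (fun x hx => hasDerivAt_rieszReal_of_pos (hpos x hx)) hi⟩
  exact ⟨(intervalIntegrable_iff_integrableOn_Ioc_of_le hab).1 key.1, by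
    rw [← intervalIntegral.integral_of_le hab, key.2]⟩

/-- The tent function of half-width `r`. -/
noncomputable def tent (r x : ℝ) : ℝ := max (r - |x|) 0

/-- On the positive half-line the tent has slope `-1` before `r` and `0` after it. -/
theorem tent_sub_tent_eq {a b r : ℝ} (ha : 0 ≤ a) (hab : a ≤ b) :
    ENNReal.ofReal (tent r a - tent r b) = ∫⁻ y in Ioc a b, (Iio r).indicator 1 y := by
  rw [lintegral_indicator_one measurableSet_Iio, Measure.restrict_apply measurableSet_Iio,
    tent, tent, abs_of_nonneg ha, abs_of_nonneg (ha.trans hab)]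
  rcases le_total r b with h | h
  · have : Iio r ∩ Ioc a b = Ioo a r := by
      ext y; simp only [mem_inter_iff, mem_Iio, mem_Ioc, mem_Ioo]
      constructor
      · rintro ⟨h1, h2, h3⟩; exact ⟨h2, h1⟩
      · rintro ⟨h1, h2⟩; exact ⟨h2, h1, by linarith⟩
    rw [this, Real.volume_Ioo, max_eq_right (by linarith : r - b ≤ 0), sub_zero]
    rcases le_total a r with h1 | h1
    · rw [max_eq_left (by linarith)]
    · rw [max_eq_right (by linarith), ENNReal.ofReal_of_nonpos (by linarith : r - a ≤ 0)]; simp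
  · have h0 : (Iio r ∩ Ioc a b : Set ℝ) =ᵐ[volume] Ioc a b := by
      have : ∀ᵐ y ∂(volume : Measure ℝ), y ≠ b := Measure.ae_ne volume b
      filter_upwards [this] with y hy
      refine propext ⟨fun hh => hh.2, fun hh => ⟨?_, hh⟩⟩
      exact lt_of_lt_of_le (lt_of_le_of_ne hh.2 hy) h
    rw [measure_congr h0, Real.volume_Ioc, max_eq_left (by linarith), max_eq_left (by linarith)]
    congr 1; ring

theorem tent_anti {a b r : ℝ} (hab : |a| ≤ |b|) : tent r b ≤ tent r a :=
  max_le_max (by linarith) le_rfl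

theorem measurable_tent (r : ℝ) : Measurable (tent r) := by unfold tent; fun_prop

/-- By Tonelli the integral over `r > y` of `r ^ (k - 2)` comes out; it is `y ^ (k - 1) / (1 - k)`,
a multiple of the derivative of the kernel. Working in `ℝ≥0∞` yields integrability together with the
value. -/
theorem lintegral_rpow_mul_tent_sub {k a b : ℝ} (hk : k < 1) (hab : a ≤ b)
    (ha : 0 < a ∨ 0 ≤ a ∧ 0 < k) :
    ∫⁻ r in Ioi 0, ENNReal.ofReal (r ^ (k - 2) * (tent r a - tent r b)) =
      ENNReal.ofReal ((rieszReal k b - rieszReal k a) / (slopeConst k * (1 - k))) := by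
  have ha0 : 0 ≤ a := by rcases ha with h | h <;> linarith
  have hs := slopeConst_pos k
  have hk1 : 0 < 1 - k := by linarith
  calc ∫⁻ r in Ioi 0, ENNReal.ofReal (r ^ (k - 2) * (tent r a - tent r b))
      = ∫⁻ r in Ioi 0, ∫⁻ y in Ioc a b, ENNReal.ofReal (r ^ (k - 2)) * (Iio r).indicator 1 y := by
        refine setLIntegral_congr_fun measurableSet_Ioi fun r (hr : 0 < r) => ?_
        rw [ENNReal.ofReal_mul (by positivity), tent_sub_tent_eq ha0 hab, lintegral_const_mul]
        exact measurable_one.indicator measurableSet_Iio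
    _ = ∫⁻ y in Ioc a b, ∫⁻ r in Ioi 0, ENNReal.ofReal (r ^ (k - 2)) * (Iio r).indicator 1 y := by
        refine lintegral_lintegral_swap (Measurable.aemeasurable ?_)
        refine Measurable.mul (by fun_prop) ?_
        have : MeasurableSet {z : ℝ × ℝ | z.2 < z.1} := measurableSet_lt measurable_snd measurable_fst
        exact (measurable_one.indicator this :
          Measurable ({z : ℝ × ℝ | z.2 < z.1}.indicator (1 : ℝ × ℝ → ℝ≥0∞)))
    _ = ∫⁻ y in Ioc a b, ENNReal.ofReal ((slopeConst k * (1 - k))⁻¹ *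
          (slopeConst k * y ^ (k - 1))) := by
        refine setLIntegral_congr_fun measurableSet_Ioc fun y hy => ?_
        have hy0 : 0 < y := lt_of_le_of_lt ha0 hy.1
        have e1 : ∀ r, ENNReal.ofReal (r ^ (k - 2)) * (Iio r).indicator 1 y =
            (Ioi y).indicator (fun r => ENNReal.ofReal (r ^ (k - 2))) r := fun r => by
          by_cases h : y < r <;> simp [indicator, h]
        simp only [e1]
        rw [lintegral_indicator measurableSet_Ioi, Measure.restrict_restrict measurableSet_Ioi,
          inter_eq_left.2 (Ioi_subset_Ioi hy0.le), ← ofReal_integral_eq_lintegral_ofReal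
          (integrableOn_Ioi_rpow_of_lt (by linarith) hy0), integral_Ioi_rpow_of_lt (by linarith) hy0]
        · congr 1
          rw [show k - 2 + 1 = k - 1 by ring]
          have : k - 1 ≠ 0 := by linarith
          field_simp
          ring
        · filter_upwards [ae_restrict_mem measurableSet_Ioi] with r hr
          exact Real.rpow_nonneg (hy0.trans hr).le _
    _ = _ := by
        have h := (integral_rpow_sub_one hab ha).const_mul (slopeConst k * (1 - k))⁻¹
        rw [← ofReal_integral_eq_lintegral_ofReal h.1, h.2, div_eq_inv_mul]
        filter_upwards [ae_restrict_mem measurableSet_Ioc] with y hy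
        have hy0 : 0 < y := lt_of_le_of_lt ha0 hy.1
        simp only [Pi.zero_apply]
        positivity

theorem hasIntegralOn_rpow_mul_tent_sub {k a b : ℝ} (hk : k < 1) (hab : a ≤ b)
    (ha : 0 < a ∨ 0 ≤ a ∧ 0 < k) :
    HasIntegralOn (fun r => r ^ (k - 2) * (tent r a - tent r b)) (Ioi 0)
      ((rieszReal k b - rieszReal k a) / (slopeConst k * (1 - k))) := by
  have ha0 : 0 ≤ a := by rcases ha with h | h <;> linarith
  have h := lintegral_rpow_mul_tent_sub hk hab ha
  have h0 : 0 ≤ᵐ[volume.restrict (Ioi 0)] fun r : ℝ => r ^ (k - 2) * (tent r a - tent r b) := by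
    filter_upwards [ae_restrict_mem measurableSet_Ioi] with r hr
    refine mul_nonneg (Real.rpow_nonneg (le_of_lt hr) _) (sub_nonneg.2 (tent_anti ?_))
    rwa [abs_of_nonneg ha0, abs_of_nonneg (ha0.trans hab)]
  have hm : Measurable fun r : ℝ => r ^ (k - 2) * (tent r a - tent r b) := by
    unfold tent; fun_prop
  have hV : 0 ≤ (rieszReal k b - rieszReal k a) / (slopeConst k * (1 - k)) := by
    have h3 := integral_rpow_sub_one hab ha
    have hs := slopeConst_pos k
    rw [← h3.2]
    refine div_nonneg (setIntegral_nonneg measurableSet_Ioc fun y hy => ?_)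
      (mul_nonneg hs.le (by linarith))
    have : 0 < y := lt_of_le_of_lt ha0 hy.1
    positivity
  refine ⟨(lintegral_ofReal_ne_top_iff_integrable hm.aestronglyMeasurable h0).1 (by rw [h]; simp), ?_⟩
  rw [integral_eq_lintegral_of_nonneg_ae h0 hm.aestronglyMeasurable, h, ENNReal.toReal_ofReal hV]

/-- The positive factor in the layer-cake representation of the kernel. -/
noncomputable def layerConst (k : ℝ) : ℝ := (slopeConst k * (1 - k))⁻¹

theorem layerConst_pos {k : ℝ} (hk : k < 1) : 0 < layerConst k :=
  inv_pos.2 (mul_pos (slopeConst_pos k) (by linarith))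

/-- The integrand of the layer-cake representation of the kernel. -/
noncomputable def layerKernel (k x r : ℝ) : ℝ := r ^ (k - 2) * (tent r x - tent r 1)

theorem tent_abs (r x : ℝ) : tent r |x| = tent r x := by simp [tent]

/-- Layer-cake representation of the kernel by tent functions. -/
theorem hasIntegralOn_layerKernel {k x : ℝ} (hk : k < 1) (hx : 0 < k ∨ x ≠ 0) :
    HasIntegralOn (layerKernel k x) (Ioi 0) (layerConst k * (rieszReal k 1 - rieszReal k x)) ∧
    HasIntegralOn (fun r => ‖layerKernel k x r‖) (Ioi 0)
      (layerConst k * |rieszReal k 1 - rieszReal k x|) := by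
  have ha : 0 < |x| ∨ 0 ≤ |x| ∧ 0 < k := by
    rcases hx with h | h
    · exact Or.inr ⟨abs_nonneg x, h⟩
    · exact Or.inl (abs_pos.2 h)
  -- The layer integrand has a constant sign, decided by comparing `|x|` with `1`; hence the
  -- integral of its norm is the absolute value of the integral.
  rcases le_total |x| 1 with h1 | h1
  · have h := hasIntegralOn_rpow_mul_tent_sub hk h1 ha
    simp only [tent_abs, rieszReal_abs, div_eq_inv_mul] at h
    have hV : 0 ≤ rieszReal k 1 - rieszReal k x := by
      have h3 := integral_rpow_sub_one h1 ha
      have hs := slopeConst_pos k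
      rw [rieszReal_abs] at h3
      rw [← h3.2]
      refine setIntegral_nonneg measurableSet_Ioc fun y hy => ?_
      have : 0 < y := lt_of_le_of_lt (abs_nonneg x) hy.1
      positivity
    refine ⟨h, h.congr measurableSet_Ioi (fun r (hr : 0 < r) => ?_) (by rw [abs_of_nonneg hV]; rfl)⟩
    rw [Real.norm_eq_abs, abs_of_nonneg]
    · rfl
    · exact mul_nonneg (by positivity) (sub_nonneg.2 (tent_anti (by simpa using h1)))
  · have h := hasIntegralOn_rpow_mul_tent_sub hk h1 (Or.inl one_pos)
    simp only [tent_abs, rieszReal_abs, div_eq_inv_mul] at h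
    have hV : 0 ≤ rieszReal k x - rieszReal k 1 := by
      have h3 := integral_rpow_sub_one (k := k) h1 (Or.inl one_pos)
      have hs := slopeConst_pos k
      rw [rieszReal_abs] at h3
      rw [← h3.2]
      refine setIntegral_nonneg measurableSet_Ioc fun y hy => ?_
      have : 0 < y := lt_trans one_pos hy.1
      positivity
    refine ⟨(h.const_mul (-1)).congr measurableSet_Ioi (fun r _ => ?_) ?_,
      h.congr measurableSet_Ioi (fun r (hr : 0 < r) => ?_) ?_⟩
    · unfold layerKernel; ring
    · unfold layerConst; ring
    · rw [Real.norm_eq_abs, layerKernel, ← abs_neg, ← mul_neg, neg_sub, abs_of_nonneg]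
      exact mul_nonneg (by positivity) (sub_nonneg.2 (tent_anti (by simpa using h1)))
    · rw [abs_sub_comm, abs_of_nonneg hV]; rfl

/-! ### Strict positive definiteness -/

/-- A window `[u, u + r]` contains both points exactly when `max x y - r ≤ u ≤ min x y`, an interval
of length `r - |x - y|` when this is nonnegative. -/
theorem lintegral_indicator_mul_Icc (x y r : ℝ) :
    ∫⁻ u, (Icc u (u + r)).indicator 1 x * (Icc u (u + r)).indicator 1 y =
      ENNReal.ofReal (tent r (x - y)) := by
  have : ∀ u : ℝ, (Icc u (u + r)).indicator (1 : ℝ → ℝ≥0∞) x * (Icc u (u + r)).indicator 1 y =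
      (Icc (max x y - r) (min x y)).indicator 1 u := fun u => by
    simp only [indicator, mem_Icc, Pi.one_apply, le_min_iff, sub_le_iff_le_add, max_le_iff]
    split_ifs <;> simp_all
  simp only [this]
  rw [lintegral_indicator_one measurableSet_Icc, Real.volume_Icc, tent]
  have h : min x y - (max x y - r) = r - |x - y| := by
    rcases le_total x y with h | h
    · rw [min_eq_left h, max_eq_right h, abs_of_nonpos (by linarith)]; ring
    · rw [min_eq_right h, max_eq_left h, abs_of_nonneg (by linarith)]; ring
  rw [h]
  rcases le_total 0 (r - |x - y|) with h1 | h1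
  · rw [max_eq_left h1]
  · rw [max_eq_right h1, ENNReal.ofReal_of_nonpos h1]; simp

theorem measurableSet_sliding (r : ℝ) : MeasurableSet {z : ℝ × ℝ | z.2 ∈ Icc z.1 (z.1 + r)} :=
  (measurableSet_le measurable_fst measurable_snd).inter
    (measurableSet_le measurable_snd (measurable_fst.add_const r))

theorem measurable_sliding (μ : Measure ℝ) [SFinite μ] (r : ℝ) :
    Measurable fun u => μ (Icc u (u + r)) :=
  measurable_measure_prodMk_left (measurableSet_sliding r)

theorem lintegral_measure_mul_measure (μ ν : Measure ℝ) [SFinite μ] [SFinite ν] (r : ℝ) :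
    ∫⁻ u, μ (Icc u (u + r)) * ν (Icc u (u + r)) =
      ∫⁻ z, ENNReal.ofReal (tent r (z.1 - z.2)) ∂μ.prod ν := by
  have hm : Measurable (fun z : ℝ × ℝ => (Icc z.1 (z.1 + r)).indicator (1 : ℝ → ℝ≥0∞) z.2) :=
    (measurable_one.indicator (measurableSet_sliding r) :
      Measurable ({z : ℝ × ℝ | z.2 ∈ Icc z.1 (z.1 + r)}.indicator (1 : ℝ × ℝ → ℝ≥0∞)))
  calc ∫⁻ u, μ (Icc u (u + r)) * ν (Icc u (u + r))
      = ∫⁻ u : ℝ, ∫⁻ z : ℝ × ℝ, (Icc u (u + r)).indicator 1 z.1 * (Icc u (u + r)).indicator 1 z.2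
          ∂μ.prod ν := by
        refine lintegral_congr fun u => ?_
        rw [lintegral_prod_mul (measurable_one.indicator measurableSet_Icc).aemeasurable
          (measurable_one.indicator measurableSet_Icc).aemeasurable,
          lintegral_indicator_one measurableSet_Icc, lintegral_indicator_one measurableSet_Icc]
    _ = ∫⁻ z : ℝ × ℝ, (∫⁻ u : ℝ, (Icc u (u + r)).indicator 1 z.1 *
          (Icc u (u + r)).indicator 1 z.2) ∂μ.prod ν := by
        refine lintegral_lintegral_swap (Measurable.aemeasurable ?_)
        exact (hm.comp (measurable_fst.prodMk (measurable_fst.comp measurable_snd))).mul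
          (hm.comp (measurable_fst.prodMk (measurable_snd.comp measurable_snd)))
    _ = _ := lintegral_congr fun z => lintegral_indicator_mul_Icc _ _ _

theorem tent_nonneg (r x : ℝ) : 0 ≤ tent r x := le_max_right _ _

theorem tent_le {r : ℝ} (hr : 0 ≤ r) (x : ℝ) : tent r x ≤ r :=
  max_le (by linarith [abs_nonneg x]) hr

theorem measurable_tent_sub (r : ℝ) : Measurable fun z : ℝ × ℝ => tent r (z.1 - z.2) :=
  (measurable_tent r).comp (measurable_fst.sub measurable_snd)

section probability

variable (μ ν : Measure ℝ) [IsProbabilityMeasure μ] [IsProbabilityMeasure ν]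

theorem integrable_tent {r : ℝ} (hr : 0 ≤ r) :
    Integrable (fun z : ℝ × ℝ => tent r (z.1 - z.2)) (μ.prod ν) :=
  Integrable.of_bound (measurable_tent_sub r).aestronglyMeasurable r
    (Filter.Eventually.of_forall fun z => by
      rw [Real.norm_eq_abs, abs_of_nonneg (tent_nonneg _ _)]; exact tent_le hr _)

theorem integral_measureReal_mul {r : ℝ} (hr : 0 ≤ r) :
    Integrable (fun u => μ.real (Icc u (u + r)) * ν.real (Icc u (u + r))) ∧
    ∫ u, μ.real (Icc u (u + r)) * ν.real (Icc u (u + r)) =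
      ∫ z, tent r (z.1 - z.2) ∂μ.prod ν := by
  have hm : Measurable (fun u => μ.real (Icc u (u + r)) * ν.real (Icc u (u + r))) :=
    (measurable_sliding μ r).ennreal_toReal.mul (measurable_sliding ν r).ennreal_toReal
  have h0 : ∀ u, 0 ≤ μ.real (Icc u (u + r)) * ν.real (Icc u (u + r)) := fun u => by positivity
  have he : ∫⁻ u, ENNReal.ofReal (μ.real (Icc u (u + r)) * ν.real (Icc u (u + r))) =
      ∫⁻ z, ENNReal.ofReal (tent r (z.1 - z.2)) ∂μ.prod ν := by
    rw [← lintegral_measure_mul_measure]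
    refine lintegral_congr fun u => ?_
    rw [ENNReal.ofReal_mul measureReal_nonneg, ofReal_measureReal, ofReal_measureReal]
  constructor
  · refine (lintegral_ofReal_ne_top_iff_integrable hm.aestronglyMeasurable
      (Filter.Eventually.of_forall h0)).1 ?_
    rw [he]
    exact (lintegral_ofReal_ne_top_iff_integrable (measurable_tent_sub r).aestronglyMeasurable
      (Filter.Eventually.of_forall fun z => tent_nonneg _ _)).2 (integrable_tent μ ν hr)
  · rw [integral_eq_lintegral_of_nonneg_ae (Filter.Eventually.of_forall h0)
      hm.aestronglyMeasurable, he, ← integral_eq_lintegral_of_nonneg_ae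
      (Filter.Eventually.of_forall fun z => tent_nonneg _ _)
      (measurable_tent_sub r).aestronglyMeasurable]

/-- Expanding the square shows that the tent energy of `μ - ν` is a squared `L²` norm. -/
theorem integral_sq_measureReal_sub {r : ℝ} (hr : 0 ≤ r) :
    Integrable (fun u => (μ.real (Icc u (u + r)) - ν.real (Icc u (u + r))) ^ 2) ∧
    ∫ u, (μ.real (Icc u (u + r)) - ν.real (Icc u (u + r))) ^ 2 =
      ∫ z, tent r (z.1 - z.2) ∂μ.prod μ + ∫ z, tent r (z.1 - z.2) ∂ν.prod ν -
        2 * ∫ z, tent r (z.1 - z.2) ∂μ.prod ν := by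
  obtain ⟨i1, e1⟩ := integral_measureReal_mul μ μ hr
  obtain ⟨i2, e2⟩ := integral_measureReal_mul ν ν hr
  obtain ⟨i3, e3⟩ := integral_measureReal_mul μ ν hr
  have he : (fun u => (μ.real (Icc u (u + r)) - ν.real (Icc u (u + r))) ^ 2) = fun u =>
      μ.real (Icc u (u + r)) * μ.real (Icc u (u + r)) +
      ν.real (Icc u (u + r)) * ν.real (Icc u (u + r)) -
      2 * (μ.real (Icc u (u + r)) * ν.real (Icc u (u + r))) := by ext u; ring
  rw [he]
  refine ⟨(i1.add i2).sub (i3.const_mul 2), ?_⟩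
  have e := integral_sub (i1.add i2) (i3.const_mul 2)
  simp only [Pi.add_apply] at e
  rw [e, integral_add i1 i2, integral_const_mul,
    e1, e2, e3]

/-- Layer-cake representation of the mutual energy. -/
theorem hasIntegralOn_layer_energy {k : ℝ} (hk : k < 1)
    (hdiag : 0 < k ∨ ∀ᵐ z ∂μ.prod ν, z.1 ≠ z.2)
    (hint : Integrable (fun z : ℝ × ℝ => rieszReal k (z.1 - z.2)) (μ.prod ν)) :
    HasIntegralOn (fun r => r ^ (k - 2) * (∫ z, tent r (z.1 - z.2) ∂μ.prod ν - tent r 1)) (Ioi 0)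
      (layerConst k * (rieszReal k 1 - ∫ z, rieszReal k (z.1 - z.2) ∂μ.prod ν)) := by
  have hd : ∀ᵐ z ∂μ.prod ν, 0 < k ∨ z.1 - z.2 ≠ 0 := by
    rcases hdiag with h | h
    · exact Filter.Eventually.of_forall fun z => Or.inl h
    · filter_upwards [h] with z hz using Or.inr (sub_ne_zero.2 hz)
  have hm : Measurable fun w : (ℝ × ℝ) × ℝ => layerKernel k (w.1.1 - w.1.2) w.2 := by
    unfold layerKernel tent
    fun_prop
  have hI : Integrable (fun w : (ℝ × ℝ) × ℝ => layerKernel k (w.1.1 - w.1.2) w.2)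
      ((μ.prod ν).prod (volume.restrict (Ioi 0))) := by
    rw [integrable_prod_iff hm.aestronglyMeasurable]
    refine ⟨hd.mono fun z hz => (hasIntegralOn_layerKernel hk hz).1.1, ?_⟩
    -- The norm version of the layer formula turns integrability of the kernel into integrability on
    -- the product, as Fubini requires.
    refine (((integrable_const (rieszReal k 1)).sub hint).abs.const_mul (layerConst k)).congr ?_
    filter_upwards [hd] with z hz
    exact (hasIntegralOn_layerKernel hk hz).2.2.symm
  have hin : ∀ r ∈ Ioi (0 : ℝ), ∫ z, layerKernel k (z.1 - z.2) r ∂μ.prod ν =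
      r ^ (k - 2) * (∫ z, tent r (z.1 - z.2) ∂μ.prod ν - tent r 1) := fun r (hr : 0 < r) => by
    unfold layerKernel
    rw [integral_const_mul, integral_sub (integrable_tent μ ν hr.le) (integrable_const _)]
    simp
  refine ⟨(hI.integral_prod_right).congr ?_, ?_⟩
  · filter_upwards [ae_restrict_mem measurableSet_Ioi] with r hr using hin r hr
  · rw [← setIntegral_congr_fun measurableSet_Ioi hin, ← integral_prod_symm _ hI, integral_prod _ hI]
    have : ∀ᵐ z ∂μ.prod ν, ∫ r in Ioi 0, layerKernel k (z.1 - z.2) r =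
        layerConst k * (rieszReal k 1 - rieszReal k (z.1 - z.2)) :=
      hd.mono fun z hz => (hasIntegralOn_layerKernel hk hz).1.2
    rw [integral_congr_ae this, integral_const_mul, integral_sub (integrable_const _) hint]
    simp

/-- The energy of the difference of two probability measures, by layers. -/
theorem hasIntegralOn_energy_diff {k : ℝ} (hk : k < 1)
    (hμμ : 0 < k ∨ ∀ᵐ z ∂μ.prod μ, z.1 ≠ z.2) (hμν : 0 < k ∨ ∀ᵐ z ∂μ.prod ν, z.1 ≠ z.2)
    (hνν : 0 < k ∨ ∀ᵐ z ∂ν.prod ν, z.1 ≠ z.2)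
    (iμμ : Integrable (fun z : ℝ × ℝ => rieszReal k (z.1 - z.2)) (μ.prod μ))
    (iμν : Integrable (fun z : ℝ × ℝ => rieszReal k (z.1 - z.2)) (μ.prod ν))
    (iνν : Integrable (fun z : ℝ × ℝ => rieszReal k (z.1 - z.2)) (ν.prod ν)) :
    HasIntegralOn (fun r => r ^ (k - 2) *
      ∫ u, (μ.real (Icc u (u + r)) - ν.real (Icc u (u + r))) ^ 2) (Ioi 0)
      (layerConst k * (2 * (∫ z, rieszReal k (z.1 - z.2) ∂μ.prod ν) -
        ∫ z, rieszReal k (z.1 - z.2) ∂μ.prod μ - ∫ z, rieszReal k (z.1 - z.2) ∂ν.prod ν)) := by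
  -- The renormalising terms `tent r 1` and `rieszReal k 1` cancel, with weights `1 + 1 - 2`,
  -- because both measures have mass one.
  refine (((hasIntegralOn_layer_energy μ μ hk hμμ iμμ).add
    (hasIntegralOn_layer_energy ν ν hk hνν iνν)).sub
    ((hasIntegralOn_layer_energy μ ν hk hμν iμν).const_mul 2)).congr measurableSet_Ioi
    (fun r (hr : 0 < r) => ?_) (by ring)
  rw [(integral_sq_measureReal_sub μ ν hr.le).2]
  ring

variable {μ ν}

/-- An almost sure equality holds on a dense set; approach `a` from the left along it and use
continuity from above. -/
theorem measure_eq_of_ae_Ici (h : ∀ᵐ u : ℝ, μ (Ici u) = ν (Ici u)) : μ = ν := by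
  refine Measure.ext_of_Ici _ _ fun a => ?_
  have hd : Dense {u : ℝ | μ (Ici u) = ν (Ici u)} := Measure.dense_of_ae h
  obtain ⟨u, hu1, hu2, hu3⟩ := hd.exists_seq_strictMono_tendsto a
  have hI : Ici a = ⋂ n, Ici (u n) := by
    ext x
    simp only [mem_Ici, mem_iInter]
    exact ⟨fun hx n => (hu2 n).1.le.trans hx, fun hx => le_of_tendsto' hu3 hx⟩
  have key : ∀ ρ : Measure ℝ, IsProbabilityMeasure ρ →
      Filter.Tendsto (fun n => ρ (Ici (u n))) Filter.atTop (nhds (ρ (Ici a))) := fun ρ _ => by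
    rw [hI]
    exact tendsto_measure_iInter_atTop (fun n => measurableSet_Ici.nullMeasurableSet)
      (fun m n hmn => Ici_subset_Ici.2 (hu1.monotone hmn)) ⟨0, measure_ne_top _ _⟩
  refine tendsto_nhds_unique (key μ inferInstance) ?_
  refine (key ν inferInstance).congr fun n => ?_
  exact (hu2 n).2.symm

/-- One good length in each `(n, n + 1)` suffices: these windows increase to the half-line `[u, ∞)`.
-/
theorem measure_eq_of_ae_Icc
    (h : ∀ᵐ r ∂(volume.restrict (Ioi (0 : ℝ))), ∀ᵐ u : ℝ, μ (Icc u (u + r)) = ν (Icc u (u + r))) :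
    μ = ν := by
  rw [ae_restrict_iff' measurableSet_Ioi] at h
  have hex : ∀ n : ℕ, ∃ r ∈ Ioo (n : ℝ) (n + 1), ∀ᵐ u : ℝ, μ (Icc u (u + r)) = ν (Icc u (u + r)) := by
    intro n
    obtain ⟨r, hr1, hr2⟩ := (Measure.dense_of_ae h).exists_mem_open isOpen_Ioo
      (nonempty_Ioo.2 (lt_add_one (n : ℝ)))
    exact ⟨r, hr2, hr1 (lt_of_le_of_lt n.cast_nonneg hr2.1)⟩
  choose r hr1 hr2 using hex
  refine measure_eq_of_ae_Ici ?_
  filter_upwards [ae_all_iff.2 hr2] with u hu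
  have hU : Ici u = ⋃ n, Icc u (u + r n) := by
    ext x
    simp only [mem_Ici, mem_iUnion, mem_Icc]
    refine ⟨fun hx => ?_, fun ⟨n, hx⟩ => hx.1⟩
    obtain ⟨n, hn⟩ := exists_nat_gt (x - u)
    exact ⟨n, hx, by linarith [(hr1 n).1]⟩
  have hmono : Monotone fun n => Icc u (u + r n) := by
    refine monotone_nat_of_le_succ fun n => Icc_subset_Icc le_rfl ?_
    have h1 := (hr1 n).2
    have h2 := (hr1 (n + 1)).1
    push_cast at h2
    linarith
  have key : ∀ ρ : Measure ℝ, Filter.Tendsto (fun n => ρ (Icc u (u + r n))) Filter.atTop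
      (nhds (ρ (Ici u))) := fun ρ => by
    rw [hU]
    exact tendsto_measure_iUnion_atTop hmono
  refine tendsto_nhds_unique (key μ) ((key ν).congr fun n => (hu n).symm)

/-- Strict positive-definiteness of the energy on differences of probability measures. -/
theorem mutual_energy_inequality {k : ℝ} (hk : k < 1)
    (hμμ : 0 < k ∨ ∀ᵐ z ∂μ.prod μ, z.1 ≠ z.2) (hμν : 0 < k ∨ ∀ᵐ z ∂μ.prod ν, z.1 ≠ z.2)
    (hνν : 0 < k ∨ ∀ᵐ z ∂ν.prod ν, z.1 ≠ z.2)
    (iμμ : Integrable (fun z : ℝ × ℝ => rieszReal k (z.1 - z.2)) (μ.prod μ))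
    (iμν : Integrable (fun z : ℝ × ℝ => rieszReal k (z.1 - z.2)) (μ.prod ν))
    (iνν : Integrable (fun z : ℝ × ℝ => rieszReal k (z.1 - z.2)) (ν.prod ν)) :
    ∫ z, rieszReal k (z.1 - z.2) ∂μ.prod μ + ∫ z, rieszReal k (z.1 - z.2) ∂ν.prod ν ≤
        2 * ∫ z, rieszReal k (z.1 - z.2) ∂μ.prod ν ∧
      (∫ z, rieszReal k (z.1 - z.2) ∂μ.prod μ + ∫ z, rieszReal k (z.1 - z.2) ∂ν.prod ν =
        2 * ∫ z, rieszReal k (z.1 - z.2) ∂μ.prod ν → μ = ν) := by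
  have h := hasIntegralOn_energy_diff μ ν hk hμμ hμν hνν iμμ iμν iνν
  have hc := layerConst_pos hk
  have h0 : ∀ r ∈ Ioi (0 : ℝ), 0 ≤ r ^ (k - 2) *
      ∫ u, (μ.real (Icc u (u + r)) - ν.real (Icc u (u + r))) ^ 2 := fun r (hr : 0 < r) =>
    mul_nonneg (by positivity) (integral_nonneg fun u => sq_nonneg _)
  constructor
  · have h1 := setIntegral_nonneg (μ := volume) measurableSet_Ioi h0
    rw [h.2] at h1
    have := nonneg_of_mul_nonneg_right h1 hc
    linarith
  · intro he
    have h1 := h.2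
    rw [show 2 * (∫ z, rieszReal k (z.1 - z.2) ∂μ.prod ν) -
        ∫ z, rieszReal k (z.1 - z.2) ∂μ.prod μ - ∫ z, rieszReal k (z.1 - z.2) ∂ν.prod ν = 0 by
        linarith, mul_zero, setIntegral_eq_zero_iff_of_nonneg_ae
        ((ae_restrict_mem measurableSet_Ioi).mono fun r hr => h0 r hr) h.1] at h1
    refine measure_eq_of_ae_Icc ?_
    filter_upwards [h1, ae_restrict_mem measurableSet_Ioi] with r hr (hr0 : 0 < r)
    have h2 : ∫ u, (μ.real (Icc u (u + r)) - ν.real (Icc u (u + r))) ^ 2 = 0 :=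
      (mul_eq_zero.1 hr).resolve_left (Real.rpow_pos_of_pos hr0 _).ne'
    rw [integral_eq_zero_iff_of_nonneg (fun u => sq_nonneg _)
      (integral_sq_measureReal_sub μ ν hr0.le).1] at h2
    filter_upwards [h2] with u hu
    have h3 : μ.real (Icc u (u + r)) = ν.real (Icc u (u + r)) := by
      have : (μ.real (Icc u (u + r)) - ν.real (Icc u (u + r))) ^ 2 = 0 := hu
      exact sub_eq_zero.1 (pow_eq_zero_iff two_ne_zero |>.1 this)
    rw [← ofReal_measureReal, h3, ofReal_measureReal]

end probability

/-! ### The energy functional and finiteness -/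

/-- Linear growth is beaten by the quadratic confinement, so the energy integrand is bounded below
and controls second moments. -/
theorem rieszReal_le {k : ℝ} (hk : k < 1) (x : ℝ) : rieszReal k x ≤ 1 + |x| := by
  have hx := abs_nonneg x
  unfold rieszReal
  split_ifs with h
  · rcases hx.eq_or_lt with h0 | h0
    · rw [← h0]; simp
    · linarith [Real.log_le_sub_one_of_pos h0]
  · rcases lt_or_gt_of_ne h with h1 | h1
    · rw [Real.sign_of_neg h1]
      have := Real.rpow_nonneg hx k
      linarith
    · rw [Real.sign_of_pos h1, one_mul]
      rcases le_total |x| 1 with h2 | h2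
      · linarith [Real.rpow_le_one hx h2 h1.le]
      · have := Real.rpow_le_rpow_of_exponent_le h2 hk.le
        rw [Real.rpow_one] at this
        linarith

/-- The real-valued integrand of the energy. -/
noncomputable def energyIntegrand (k : ℝ) (z : ℝ × ℝ) : ℝ :=
  z.1 ^ 2 / 2 + z.2 ^ 2 / 2 - rieszReal k (z.1 - z.2)

theorem measurable_rieszReal_sub (k : ℝ) : Measurable fun z : ℝ × ℝ => rieszReal k (z.1 - z.2) :=
  (measurable_rieszReal k).comp (measurable_fst.sub measurable_snd)

theorem measurable_energyIntegrand (k : ℝ) : Measurable (energyIntegrand k) :=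
  Measurable.sub (by fun_prop) (measurable_rieszReal_sub k)

theorem le_energyIntegrand {k : ℝ} (hk : k < 1) (z : ℝ × ℝ) :
    (z.1 ^ 2 + z.2 ^ 2) / 4 - 3 ≤ energyIntegrand k z := by
  have h1 := rieszReal_le hk (z.1 - z.2)
  have h2 := abs_sub z.1 z.2
  have h3 : |z.1| ≤ z.1 ^ 2 / 4 + 1 := by nlinarith [sq_nonneg (|z.1| - 2), sq_abs z.1]
  have h4 : |z.2| ≤ z.2 ^ 2 / 4 + 1 := by nlinarith [sq_nonneg (|z.2| - 2), sq_abs z.2]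
  unfold energyIntegrand
  linarith

/-- The extended-real integrand of the energy. -/
noncomputable def energyKernel (k : ℝ) (z : ℝ × ℝ) : EReal :=
  ((z.1 ^ 2 / 2 + z.2 ^ 2 / 2 : ℝ) : EReal) - rieszKernel k (z.1 - z.2)

theorem energyKernel_eq {k : ℝ} {z : ℝ × ℝ} (h : 0 < k ∨ z.1 ≠ z.2) :
    energyKernel k z = (energyIntegrand k z : ℝ) := by
  have h1 : ¬ (z.1 - z.2 = 0 ∧ k ≤ 0) := fun ⟨h2, h3⟩ => by
    rcases h with h | h
    · linarith
    · exact h (sub_eq_zero.1 h2)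
  unfold energyKernel rieszKernel energyIntegrand rieszReal
  rw [if_neg h1]
  split_ifs <;> norm_cast

theorem energyKernel_eq_top {k : ℝ} {z : ℝ × ℝ} (h : ¬ (0 < k ∨ z.1 ≠ z.2)) :
    energyKernel k z = ⊤ := by
  push Not at h
  unfold energyKernel rieszKernel
  rw [if_pos ⟨sub_eq_zero.2 h.2, h.1⟩]
  rfl

theorem integrable_fst_of_prod {μ ν : Measure ℝ} [IsProbabilityMeasure μ] [IsProbabilityMeasure ν]
    {f : ℝ → ℝ} (hf : Measurable f) :
    Integrable (fun z : ℝ × ℝ => f z.1) (μ.prod ν) ↔ Integrable f μ :=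
  measurePreserving_fst.integrable_comp hf.aestronglyMeasurable

theorem extIntegral_eq_coe {f : ℝ × ℝ → EReal} {g : ℝ × ℝ → ℝ} {ρ : Measure (ℝ × ℝ)}
    (h : ∀ᵐ z ∂ρ, f z = (g z : ℝ)) (hg : Integrable g ρ) :
    extIntegral ρ f = ((∫ z, g z ∂ρ : ℝ) : EReal) := by
  have h1 : ∫⁻ z, (f z).toENNReal ∂ρ = ∫⁻ z, ENNReal.ofReal (g z) ∂ρ := by
    refine lintegral_congr_ae (h.mono fun z hz => ?_)
    simp only
    rw [hz, EReal.real_coe_toENNReal]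
  have h2 : ∫⁻ z, (-f z).toENNReal ∂ρ = ∫⁻ z, ENNReal.ofReal (-g z) ∂ρ := by
    refine lintegral_congr_ae (h.mono fun z hz => ?_)
    simp only
    rw [hz, ← EReal.coe_neg, EReal.real_coe_toENNReal]
  unfold extIntegral
  rw [h1, h2, integral_eq_lintegral_pos_part_sub_lintegral_neg_part hg, EReal.coe_sub]
  have e1 : ∫⁻ z, ENNReal.ofReal (g z) ∂ρ ≠ ⊤ := hg.lintegral_lt_top.ne
  have e2 : ∫⁻ z, ENNReal.ofReal (-g z) ∂ρ ≠ ⊤ := hg.neg.lintegral_lt_top.ne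
  rw [EReal.coe_ennreal_toReal e1, EReal.coe_ennreal_toReal e2]

theorem rieszEnergy_eq {k : ℝ} {μ : Measure ℝ} (hd : 0 < k ∨ ∀ᵐ z ∂μ.prod μ, z.1 ≠ z.2)
    (hi : Integrable (energyIntegrand k) (μ.prod μ)) :
    rieszEnergy (fun x => x ^ 2) k μ = ((∫ z, energyIntegrand k z ∂μ.prod μ : ℝ) : EReal) := by
  refine extIntegral_eq_coe ?_ hi
  rcases hd with h | h
  · exact Filter.Eventually.of_forall fun z => energyKernel_eq (Or.inl h)
  · exact h.mono fun z hz => energyKernel_eq (Or.inr hz)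

section energy

variable {k : ℝ} {μ : Measure ℝ} [IsProbabilityMeasure μ]

/-- A measure of finite energy does not charge the diagonal and has an integrable kernel. -/
theorem of_rieszEnergy_ne_top (hk : k < 1) (h : rieszEnergy (fun x => x ^ 2) k μ ≠ ⊤) :
    (0 < k ∨ ∀ᵐ z ∂μ.prod μ, z.1 ≠ z.2) ∧ Integrable (energyIntegrand k) (μ.prod μ) := by
  have hle : ∀ z, -3 ≤ energyIntegrand k z := fun z => by
    have := le_energyIntegrand hk z
    nlinarith [sq_nonneg z.1, sq_nonneg z.2]
  have hneg : ∫⁻ z, (-energyKernel k z).toENNReal ∂μ.prod μ ≤ 3 := by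
    calc ∫⁻ z, (-energyKernel k z).toENNReal ∂μ.prod μ ≤ ∫⁻ z, 3 ∂μ.prod μ := by
          refine lintegral_mono fun z => ?_
          by_cases hz : 0 < k ∨ z.1 ≠ z.2
          · rw [energyKernel_eq hz, ← EReal.coe_neg, EReal.real_coe_toENNReal]
            calc ENNReal.ofReal (-energyIntegrand k z) ≤ ENNReal.ofReal 3 :=
                  ENNReal.ofReal_le_ofReal (by linarith [hle z])
              _ = 3 := by simp
          · rw [energyKernel_eq_top hz]; simp
      _ = 3 := by simp
  -- The negative part being finite, an infinite positive part would make the energy `⊤`.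
  have hpos : ∫⁻ z, (energyKernel k z).toENNReal ∂μ.prod μ ≠ ⊤ := fun htop => by
    refine h ?_
    change ((∫⁻ z, (energyKernel k z).toENNReal ∂μ.prod μ : ℝ≥0∞) : EReal) -
      ((∫⁻ z, (-energyKernel k z).toENNReal ∂μ.prod μ : ℝ≥0∞) : EReal) = ⊤
    rw [htop, EReal.coe_ennreal_top]
    refine EReal.top_sub ?_
    rw [Ne, EReal.coe_ennreal_eq_top_iff]
    exact (hneg.trans_lt (by simp)).ne
  have hm := measurable_energyIntegrand k
  have hdm : MeasurableSet {z : ℝ × ℝ | z.1 = z.2} := measurableSet_diagonal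
  have hd : 0 < k ∨ ∀ᵐ z ∂μ.prod μ, z.1 ≠ z.2 := by
    by_cases hk0 : 0 < k
    · exact Or.inl hk0
    refine Or.inr ?_
    rw [ae_iff]
    by_contra hne
    refine hpos (top_unique ?_)
    -- For `k ≤ 0` the kernel is `⊤` on the diagonal, so a charged diagonal makes the positive part
    -- infinite.
    calc (⊤ : ℝ≥0∞) = ∫⁻ z in {z : ℝ × ℝ | z.1 = z.2}, ⊤ ∂μ.prod μ := by
          rw [setLIntegral_const, ENNReal.top_mul]
          simpa using hne
      _ = ∫⁻ z in {z : ℝ × ℝ | z.1 = z.2}, (energyKernel k z).toENNReal ∂μ.prod μ := by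
          refine setLIntegral_congr_fun hdm fun z (hz : z.1 = z.2) => ?_
          rw [energyKernel_eq_top (by push Not; exact ⟨not_lt.1 hk0, hz⟩)]
          simp
      _ ≤ _ := setLIntegral_le_lintegral _ _
  have hae : ∀ᵐ z ∂μ.prod μ, energyKernel k z = (energyIntegrand k z : ℝ) := by
    rcases hd with h | h
    · exact Filter.Eventually.of_forall fun z => energyKernel_eq (Or.inl h)
    · exact h.mono fun z hz => energyKernel_eq (Or.inr hz)
  refine ⟨hd, ?_⟩
  have h3 : Integrable (fun z => energyIntegrand k z + 3) (μ.prod μ) := by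
    refine (lintegral_ofReal_ne_top_iff_integrable (hm.add_const 3).aestronglyMeasurable
      (Filter.Eventually.of_forall fun z => by
        simp only [Pi.zero_apply]; linarith [hle z])).1 ?_
    have : ∫⁻ z, ENNReal.ofReal (energyIntegrand k z + 3) ∂μ.prod μ ≤
        ∫⁻ z, ((energyKernel k z).toENNReal + 3) ∂μ.prod μ := by
      refine lintegral_mono_ae (hae.mono fun z hz => ?_)
      rw [hz, EReal.real_coe_toENNReal]
      refine ENNReal.ofReal_add_le.trans ?_
      simp
    refine (this.trans_lt ?_).ne
    rw [lintegral_add_right _ measurable_const]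
    simpa using lt_top_iff_ne_top.2 hpos
  refine (h3.sub (integrable_const (3 : ℝ))).congr (Filter.Eventually.of_forall fun z => ?_)
  simp

theorem integrable_sq_of_energy (hk : k < 1) (hi : Integrable (energyIntegrand k) (μ.prod μ)) :
    Integrable (fun x => x ^ 2) μ := by
  rw [← integrable_fst_of_prod (ν := μ) (by fun_prop)]
  refine ((hi.add (integrable_const 3)).const_mul 4).mono' (by fun_prop)
    (Filter.Eventually.of_forall fun z => ?_)
  rw [Real.norm_eq_abs, abs_of_nonneg (sq_nonneg _)]
  simp only [Pi.add_apply]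
  nlinarith [le_energyIntegrand hk z, sq_nonneg z.2]

theorem integral_energyIntegrand (h2 : Integrable (fun x => x ^ 2) μ) :
    (Integrable (energyIntegrand k) (μ.prod μ) ↔
      Integrable (fun z : ℝ × ℝ => rieszReal k (z.1 - z.2)) (μ.prod μ)) ∧
    (Integrable (energyIntegrand k) (μ.prod μ) → ∫ z, energyIntegrand k z ∂μ.prod μ =
      ∫ x, x ^ 2 ∂μ - ∫ z, rieszReal k (z.1 - z.2) ∂μ.prod μ) := by
  have i1 : Integrable (fun z : ℝ × ℝ => z.1 ^ 2 / 2) (μ.prod μ) :=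
    (measurePreserving_fst.integrable_comp h2.1).2 h2 |>.div_const 2
  have i2 : Integrable (fun z : ℝ × ℝ => z.2 ^ 2 / 2) (μ.prod μ) :=
    (measurePreserving_snd.integrable_comp h2.1).2 h2 |>.div_const 2
  have hiff : Integrable (energyIntegrand k) (μ.prod μ) ↔
      Integrable (fun z : ℝ × ℝ => rieszReal k (z.1 - z.2)) (μ.prod μ) := by
    constructor
    · intro h
      refine ((i1.add i2).sub h).congr (Filter.Eventually.of_forall fun z => ?_)
      simp [energyIntegrand]
    · intro h
      exact (i1.add i2).sub h
  refine ⟨hiff, fun h => ?_⟩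
  have e := integral_sub (i1.add i2) (hiff.1 h)
  simp only [Pi.add_apply] at e
  unfold energyIntegrand
  rw [e, integral_add i1 i2, integral_div, integral_div, integral_fun_fst (fun x : ℝ => x ^ 2),
    integral_fun_snd (fun x : ℝ => x ^ 2)]
  simp

/-- If `V ≤ c` with `c ≥ 0`, then `|V| ≤ 2 * c - V`. Hence the lower bound `B` on the potential
controls the integral of `|V|` in `y`, by a function of `x` that is `μ`-integrable. -/
theorem integrable_mutual {ν : Measure ℝ} [IsProbabilityMeasure ν] {ω M B : ℝ} (hk : k < 1)
    (hμ : ∀ᵐ x ∂μ, ω ≤ x) (h2 : Integrable (fun x => x ^ 2) μ) (hM : ∀ᵐ y ∂ν, |y| ≤ M)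
    (hint : ∀ x, ω ≤ x → Integrable (fun y => rieszReal k (x - y)) ν)
    (hB : ∀ x, ω ≤ x → B ≤ ∫ y, rieszReal k (x - y) ∂ν) :
    Integrable (fun z : ℝ × ℝ => rieszReal k (z.1 - z.2)) (μ.prod ν) := by
  have hm := (measurable_rieszReal_sub k)
  rw [integrable_prod_iff hm.aestronglyMeasurable]
  refine ⟨hμ.mono fun x hx => hint x hx, ?_⟩
  have hdom : Integrable (fun x : ℝ => 2 * (2 + x ^ 2 + M) - B) μ :=
    ((((integrable_const 2).add h2).add (integrable_const M)).const_mul 2).sub (integrable_const B)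
  refine hdom.mono' hm.norm.aestronglyMeasurable.integral_prod_right' ?_
  filter_upwards [hμ] with x hx
  rw [Real.norm_eq_abs, abs_of_nonneg (integral_nonneg fun y => norm_nonneg _)]
  have hi := hint x hx
  have hle : ∫ y, ‖rieszReal k (x - y)‖ ∂ν ≤ ∫ y, (2 * (2 + x ^ 2 + M) - rieszReal k (x - y)) ∂ν := by
    refine integral_mono_ae hi.norm ((integrable_const _).sub hi) ?_
    filter_upwards [hM] with y hy
    have h1 := rieszReal_le hk (x - y)
    have h3 := abs_sub x y
    have h4 : |x| ≤ 1 + x ^ 2 := by nlinarith [sq_abs x, sq_nonneg (|x| - 1), abs_nonneg x]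
    have h5 := abs_nonneg y
    have h6 := sq_nonneg x
    rw [Real.norm_eq_abs]
    exact abs_le'.2 ⟨by linarith, by linarith⟩
  refine hle.trans ?_
  rw [integral_sub (integrable_const _) hi]
  have := hB x hx
  simp
  linarith

theorem ae_prod_ne {ν : Measure ℝ} [IsProbabilityMeasure ν] [NullSingletonClass ν] :
    ∀ᵐ z ∂μ.prod ν, z.1 ≠ z.2 := by
  have hdm : MeasurableSet {z : ℝ × ℝ | z.1 = z.2} := measurableSet_diagonal
  have : (μ.prod ν) {z : ℝ × ℝ | z.1 = z.2} = 0 := by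
    rw [Measure.prod_apply hdm]
    have : ∀ x : ℝ, Prod.mk x ⁻¹' {z : ℝ × ℝ | z.1 = z.2} = {x} := fun x => by
      ext y; simp [eq_comm]
    simp [this]
  rw [ae_iff]
  simpa using this

/-! ### Euler–Lagrange conditions imply unique minimality -/

/-- A measure satisfying the Euler–Lagrange conditions is the unique constrained minimiser. -/
theorem isWallEquilibrium_of_potential {ν : Measure ℝ} [IsProbabilityMeasure ν] [NullSingletonClass ν]
    {ω M B S : ℝ} (hk : k < 1) (hνω : ∀ᵐ x ∂ν, ω ≤ x) (hM : ∀ᵐ y ∂ν, |y| ≤ M)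
    (hint : ∀ x, ω ≤ x → Integrable (fun y => rieszReal k (x - y)) ν)
    (hB : ∀ x, ω ≤ x → B ≤ ∫ y, rieszReal k (x - y) ∂ν)
    (hle : ∀ x, ω ≤ x → ∫ y, rieszReal k (x - y) ∂ν ≤ x ^ 2 / 2 - S)
    (heq : ∀ᵐ x ∂ν, ∫ y, rieszReal k (x - y) ∂ν = x ^ 2 / 2 - S) :
    IsWallEquilibrium k ω ν ∧ wallEnergy k ω = ((S + (∫ x, x ^ 2 ∂ν) / 2 : ℝ) : EReal) := by
  have hν2 : Integrable (fun x : ℝ => x ^ 2) ν := by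
    refine Integrable.of_bound (by fun_prop) (M ^ 2) ?_
    filter_upwards [hM] with y hy
    rw [norm_pow]
    exact pow_le_pow_left₀ (norm_nonneg _) hy 2
  have iνν := integrable_mutual hk hνω hν2 hM hint hB
  have hVνν : ∫ z, rieszReal k (z.1 - z.2) ∂ν.prod ν = (∫ x, x ^ 2 ∂ν) / 2 - S := by
    rw [integral_prod _ iνν]
    simp only
    rw [integral_congr_ae heq, integral_sub (hν2.div_const 2) (integrable_const S), integral_div]
    simp
  have hEν : rieszEnergy (fun x => x ^ 2) k ν = ((S + (∫ x, x ^ 2 ∂ν) / 2 : ℝ) : EReal) := by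
    have h1 := (integral_energyIntegrand (k := k) hν2).1.2 iνν
    rw [rieszEnergy_eq (Or.inr ae_prod_ne) h1, (integral_energyIntegrand hν2).2 h1, hVνν]
    congr 1; ring
  have hνmem : ν ∈ wallMeasures ω := ⟨inferInstance, by rwa [prob_compl_eq_zero_iff
    measurableSet_Ici |>.symm, ← mem_ae_iff]⟩
  have key : ∀ μ ∈ wallMeasures ω, rieszEnergy (fun x => x ^ 2) k ν ≤ rieszEnergy (fun x => x ^ 2) k μ ∧
      (rieszEnergy (fun x => x ^ 2) k μ = rieszEnergy (fun x => x ^ 2) k ν → μ = ν) := by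
    rintro μ ⟨hμp, hμω⟩
    by_cases htop : rieszEnergy (fun x => x ^ 2) k μ = ⊤
    · rw [htop, hEν]
      exact ⟨le_top, fun h => absurd h.symm (EReal.coe_ne_top _)⟩
    obtain ⟨hd, hi⟩ := of_rieszEnergy_ne_top hk htop
    have hμω' : ∀ᵐ x ∂μ, ω ≤ x := by
      rwa [← prob_compl_eq_zero_iff measurableSet_Ici, ← mem_ae_iff] at hμω
    have hμ2 := integrable_sq_of_energy hk hi
    have iμμ := (integral_energyIntegrand (k := k) hμ2).1.1 hi
    have iμν := integrable_mutual hk hμω' hμ2 hM hint hB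
    have hVμν : ∫ z, rieszReal k (z.1 - z.2) ∂μ.prod ν ≤ (∫ x, x ^ 2 ∂μ) / 2 - S := by
      rw [integral_prod _ iμν]
      have : ∫ x, ∫ y, rieszReal k (x - y) ∂ν ∂μ ≤ ∫ x, (x ^ 2 / 2 - S) ∂μ :=
        integral_mono_ae iμν.integral_prod_left ((hμ2.div_const 2).sub (integrable_const S))
          (hμω'.mono fun x hx => hle x hx)
      refine this.trans_eq ?_
      rw [integral_sub (hμ2.div_const 2) (integrable_const S), integral_div]
      simp
    obtain ⟨h1, h2⟩ := mutual_energy_inequality hk hd (Or.inr ae_prod_ne) (Or.inr ae_prod_ne)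
      iμμ iμν iνν
    rw [hEν, rieszEnergy_eq hd hi, (integral_energyIntegrand hμ2).2 hi, EReal.coe_le_coe_iff,
      EReal.coe_eq_coe_iff]
    -- With `⟨μ,ν⟩` for the mutual integral of the kernel: `⟨μ,μ⟩ ≤ 2⟨μ,ν⟩ - ⟨ν,ν⟩`, and integrating
    -- the potential bounds gives `2⟨μ,ν⟩ ≤ ∫ x² dμ - 2S` and `⟨ν,ν⟩ = ∫ x² dν / 2 - S`. Equal
    -- energies force equality in the first inequality.
    exact ⟨by linarith, fun h => h2 (by linarith)⟩
  have hmin : wallEnergy k ω = rieszEnergy (fun x => x ^ 2) k ν :=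
    le_antisymm (iInf₂_le ν hνmem) (le_iInf₂ fun μ hμ => (key μ hμ).1)
  exact ⟨⟨hνmem, hmin.symm, fun μ hμ h => (key μ hμ).2 (h.trans hmin)⟩, hmin.trans hEν⟩

end energy

/-- All properties of the equilibrium measure that do not depend on the sign of `k`. -/
theorem wall_equilibrium {k ω h : ℝ} (hk : k ∈ Ioo (-1 : ℝ) 1) (hh : 0 < h) (hω : -h ≤ ω)
    (hm : UnitMass k ω h) {ν : Measure ℝ}
    (hν : ν = intervalMeasure ω (2 * h) (unifiedDensity k ω (2 * h))) :
    IsProbabilityMeasure ν ∧ ν.support = Icc ω (ω + 2 * h) ∧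
    (∀ x, ω ≤ x → Integrable (fun y => rieszReal k (x - y)) ν) ∧
    ∃ S : ℝ,
      (∀ x ∈ Icc ω (ω + 2 * h), 1 / 2 * x ^ 2 - ∫ y, rieszReal k (x - y) ∂ν = S) ∧
      (∀ x, ω + 2 * h ≤ x → S ≤ 1 / 2 * x ^ 2 - ∫ y, rieszReal k (x - y) ∂ν) ∧
      IsWallEquilibrium k ω ν ∧ wallEnergy k ω = ((S + (∫ x, x ^ 2 ∂ν) / 2 : ℝ) : EReal) := by
  obtain ⟨S, hS⟩ := exists_hasIntegralWrt_potential hk hh hω hm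
  have hb : ω + 2 * h ∈ Icc ω (ω + 2 * h) := ⟨by linarith, le_rfl⟩
  have hprob := isProbabilityMeasure_wall hk hh hω hm
  have hsupp := support_intervalMeasure (ω := ω) (L := 2 * h) (by positivity)
    (measurable_unifiedDensity k ω (2 * h)) (unifiedDensity_pos hk (by linarith))
  have hae := ae_intervalMeasure (ω := ω) (L := 2 * h) (g := unifiedDensity k ω (2 * h))
  have hac : intervalMeasure ω (2 * h) (unifiedDensity k ω (2 * h)) ≪ volume :=
    (withDensity_absolutelyContinuous _ _).trans Measure.restrict_le_self.absolutelyContinuous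
  have hout := fun x hx => potential_outside (x := x) hk hh hω (hS _ hb) hx
  have hmono : ∀ x, ω + 2 * h ≤ x → ∫ y, rieszReal k (ω + 2 * h - y)
      ∂(intervalMeasure ω (2 * h) (unifiedDensity k ω (2 * h))) ≤ ∫ y, rieszReal k (x - y)
      ∂(intervalMeasure ω (2 * h) (unifiedDensity k ω (2 * h))) := fun x hx => by
    refine integral_mono_ae (hS _ hb).1 (hout x hx).1 ?_
    filter_upwards [hae] with y hy
    exact (rieszReal_tangent hk.2 (by linarith [hy.2]) (by linarith)).1
  rw [← hν] at hS hprob hsupp hae hac hout hmono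
  have : NullSingletonClass ν := ⟨fun x => hac (measure_singleton x)⟩
  have hint : ∀ x, ω ≤ x → Integrable (fun y => rieszReal k (x - y)) ν := fun x hx => by
    rcases le_total x (ω + 2 * h) with h1 | h1
    · exact (hS x ⟨hx, h1⟩).1
    · exact (hout x h1).1
  -- With `b = ω + 2 * h`, the tangent bound gives `x ^ 2 / 2` minus the potential at least `S + (x
  -- - b) ^ 2 / 2`.
  have hge : ∀ x, ω + 2 * h ≤ x → S ≤ 1 / 2 * x ^ 2 - ∫ y, rieszReal k (x - y) ∂ν := fun x hx => by
    nlinarith [(hout x hx).2, sq_nonneg (x - (ω + 2 * h))]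
  refine ⟨hprob, hsupp, hint, S, fun x hx => ?_, hge, ?_⟩
  · rw [(hS x hx).2]; ring
  -- The potential is at least `-S` on the support, where it is `x ^ 2 / 2 - S`, and increases
  -- beyond it; hence `B = -S`.
  refine isWallEquilibrium_of_potential (M := |ω| + 2 * h) (B := -S) hk.2
    (hae.mono fun y hy => hy.1.le) (hae.mono fun y hy => ?_) hint (fun x hx => ?_) (fun x hx => ?_)
    (hae.mono fun y hy => ?_)
  · exact abs_le.2 ⟨by linarith [neg_abs_le ω, hy.1], by linarith [le_abs_self ω, hy.2]⟩
  · rcases le_total x (ω + 2 * h) with h1 | h1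
    · rw [(hS x ⟨hx, h1⟩).2]
      nlinarith [sq_nonneg x]
    · refine le_trans ?_ (hmono x h1)
      rw [(hS _ hb).2]
      nlinarith [sq_nonneg (ω + 2 * h)]
  · rcases le_total x (ω + 2 * h) with h1 | h1
    · rw [(hS x ⟨hx, h1⟩).2]
      exact le_of_eq (by ring)
    · linarith [hge x h1]
  · rw [(hS y (Ioo_subset_Icc_self hy)).2]; ring

/-! ### The length equation and the critical wall -/

/-- The right-hand side of the length equation, up to a power of two. -/
noncomputable def criticalValue (k : ℝ) : ℝ :=
  |k| * wallC k * Real.Gamma ((4 - k) / 2) / (√Real.pi * Real.Gamma ((3 - k) / 2))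

/-- The bridge between the Gamma quotient of the length equation and the unit-mass condition. -/
theorem criticalValue_eq {k : ℝ} (hk : k ∈ Ioo (-1 : ℝ) 1) (hk0 : k ≠ 0) :
    criticalValue k * (gegenbauerMass ((1 - k) / 2) * (1 - k)) = wallConst k * (2 - k) := by
  have h1 : 0 < 1 - k := by linarith [hk.2]
  have h2 : 0 < 2 - k := by linarith [hk.2]
  have g1 := Real.Gamma_pos_of_pos (show 0 < (1 - k) / 2 by positivity)
  have g2 := Real.Gamma_pos_of_pos (show 0 < (2 - k) / 2 by positivity)
  have hpi : 0 < √Real.pi := Real.sqrt_pos.2 Real.pi_pos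
  rw [criticalValue, wallConst, if_neg hk0, gegenbauerMass_eq (by positivity),
    show (4 - k) / 2 = (2 - k) / 2 + 1 by ring, show (3 - k) / 2 = (1 - k) / 2 + 1 by ring,
    show (1 - k) / 2 + 1 / 2 = (2 - k) / 2 by ring,
    Real.Gamma_add_one (by positivity), Real.Gamma_add_one (by positivity)]
  generalize Real.Gamma ((1 - k) / 2) = a at *
  generalize Real.Gamma ((2 - k) / 2) = b at *
  field_simp

theorem criticalValue_pos {k : ℝ} (hk : k ∈ Ioo (-1 : ℝ) 1) (hk0 : k ≠ 0) :
    0 < criticalValue k := by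
  have h1 := criticalValue_eq hk hk0
  have h2 := wallConst_pos hk
  have h3 := gegenbauerMass_pos (half_one_sub_mem hk).1
  have h4 : 0 < 1 - k := by linarith [hk.2]
  have h5 : 0 < wallConst k * (2 - k) := mul_pos h2 (by linarith)
  rw [← h1] at h5
  exact (pos_iff_pos_of_mul_pos h5).2 (mul_pos h3 h4)

theorem wallLengthEq_iff {k ω h : ℝ} (hh : 0 < h) :
    WallLengthEq k ω (2 * h) ↔ h ^ (1 - k) * ((3 - k) * h + (2 - k) * ω) = criticalValue k := by
  have e : (2 : ℝ) ^ (2 - k) = 2 * 2 ^ (1 - k) := by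
    rw [show 2 - k = (1 - k) + 1 by ring, Real.rpow_add_one two_ne_zero, mul_comm]
  have e2 : h ^ (2 - k) = h * h ^ (1 - k) := by
    rw [show 2 - k = (1 - k) + 1 by ring, Real.rpow_add_one hh.ne', mul_comm]
  have e3 : (0 : ℝ) < 2 ^ (1 - k) := by positivity
  unfold WallLengthEq
  rw [Real.mul_rpow two_pos.le hh.le, Real.mul_rpow two_pos.le hh.le, e, e2]
  have lhs : (3 - k) * (2 * 2 ^ (1 - k) * (h * h ^ (1 - k))) +
      2 * (2 - k) * ω * (2 ^ (1 - k) * h ^ (1 - k)) =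
      (2 * 2 ^ (1 - k)) * (h ^ (1 - k) * ((3 - k) * h + (2 - k) * ω)) := by ring
  have rhs : 2 * 2 ^ (1 - k) * |k| * wallC k * Real.Gamma ((4 - k) / 2) /
      (√Real.pi * Real.Gamma ((3 - k) / 2)) = (2 * 2 ^ (1 - k)) * criticalValue k := by
    unfold criticalValue; ring
  rw [lhs, rhs]
  exact mul_right_inj' (by positivity)

theorem unitMass_iff {k ω h : ℝ} (hk : k ∈ Ioo (-1 : ℝ) 1) (hk0 : k ≠ 0) (hh : 0 < h) :
    UnitMass k ω h ↔ WallLengthEq k ω (2 * h) := by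
  rw [wallLengthEq_iff hh, UnitMass, ← criticalValue_eq hk hk0, mul_assoc]
  have h3 := gegenbauerMass_pos (half_one_sub_mem hk).1
  have h4 : 0 < 1 - k := by linarith [hk.2]
  exact mul_left_inj' (mul_pos h3 h4).ne'

/-- The function need not be monotone, but where it takes the positive value `K` the linear factor
is positive, so it increases strictly from there on. -/
theorem existsUnique_rpow_mul_linear {α a b K : ℝ} (hα : 0 < α) (ha : 0 < a) (hK : 0 < K) :
    ∃ x : ℝ, 0 < x ∧ x ^ α * (a * x + b) = K ∧
      ∀ y : ℝ, 0 < y → y ^ α * (a * y + b) = K → y = x := by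
  have hmono : ∀ x y : ℝ, 0 < x → x < y → x ^ α * (a * x + b) = K →
      x ^ α * (a * x + b) < y ^ α * (a * y + b) := fun x y hx hxy h => by
    have h1 : 0 < x ^ α := Real.rpow_pos_of_pos hx α
    have h2 : 0 < a * x + b := by
      by_contra hneg
      nlinarith
    have h3 : x ^ α < y ^ α := Real.rpow_lt_rpow hx.le hxy hα
    have h4 : a * x + b < a * y + b := by nlinarith
    exact mul_lt_mul'' h3 h4 h1.le h2.le
  -- The function vanishes at `x₀`. Adding `t ≥ 1` makes the power at least `1`, and `t ≥ K / a`
  -- makes the linear factor at least `K`.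
  set x₀ := max 0 (-b / a) with hx0
  set t := max 1 (K / a) with ht
  have hx00 : 0 ≤ x₀ := le_max_left _ _
  have ht1 : 1 ≤ t := le_max_left _ _
  have hb : 0 ≤ a * x₀ + b := by
    have := le_max_right 0 (-b / a)
    rw [← hx0, div_le_iff₀ ha] at this
    linarith
  have hf0 : x₀ ^ α * (a * x₀ + b) = 0 := by
    rcases le_total (-b / a) 0 with h | h
    · rw [hx0, max_eq_left h, Real.zero_rpow hα.ne', zero_mul]
    · rw [hx0, max_eq_right h]
      have : a * (-b / a) + b = 0 := by field_simp; ring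
      rw [this, mul_zero]
  have hf1 : K ≤ (x₀ + t) ^ α * (a * (x₀ + t) + b) := by
    have h1 : 1 ≤ (x₀ + t) ^ α := Real.one_le_rpow (by linarith) hα.le
    have h2 : K ≤ a * t := by
      have := le_max_right 1 (K / a)
      rw [← ht, div_le_iff₀ ha] at this
      linarith
    have h3 : K ≤ a * (x₀ + t) + b := by linarith
    nlinarith
  have hcont : Continuous fun x : ℝ => x ^ α * (a * x + b) :=
    (Real.continuous_rpow_const hα.le).mul (by fun_prop)
  obtain ⟨x, hx, hxK⟩ := intermediate_value_Icc (by linarith : x₀ ≤ x₀ + t) hcont.continuousOn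
    (show K ∈ Icc (x₀ ^ α * (a * x₀ + b)) _ from ⟨by rw [hf0]; exact hK.le, hf1⟩)
  simp only at hxK
  have hx' : 0 < x := by
    refine lt_of_le_of_ne (hx00.trans hx.1) fun h0 => ?_
    rw [← h0, Real.zero_rpow hα.ne', zero_mul] at hxK
    linarith
  refine ⟨x, hx', hxK, fun y hy hyK => ?_⟩
  rcases lt_trichotomy x y with h | h | h
  · have := hmono x y hx' h hxK; linarith
  · exact h.symm
  · have := hmono y x hy h hyK; linarith

/-- If `ω < -h`, the linear factor is below `h`, so the critical value is below `h ^ (2 - k)`. But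
`h < -ω ≤ criticalWall k` puts `h ^ (2 - k)` below that same critical value. -/
theorem neg_le_of_criticalWall {k ω h : ℝ} (hk : k ∈ Ioo (-1 : ℝ) 1) (hk0 : k ≠ 0) (hh : 0 < h)
    (heq : h ^ (1 - k) * ((3 - k) * h + (2 - k) * ω) = criticalValue k)
    (hω : -criticalWall k ≤ ω) : -h ≤ ω := by
  by_contra hlt
  push Not at hlt
  have hK := criticalValue_pos hk hk0
  have h2 : 0 < 2 - k := by linarith [hk.2]
  have e2 : h ^ (2 - k) = h ^ (1 - k) * h := by
    rw [show 2 - k = (1 - k) + 1 by ring, Real.rpow_add_one hh.ne']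
  have e3 : criticalWall k ^ (2 - k) = criticalValue k := by
    change (criticalValue k ^ (1 / (2 - k))) ^ (2 - k) = _
    rw [← Real.rpow_mul hK.le, one_div_mul_cancel h2.ne', Real.rpow_one]
  have h3 : h ^ (2 - k) < criticalWall k ^ (2 - k) :=
    Real.rpow_lt_rpow hh.le (by linarith) h2
  have h4 : 0 < h ^ (1 - k) := by positivity
  have h5 : (3 - k) * h + (2 - k) * ω < h := by nlinarith
  rw [e3, ← heq, e2] at h3
  nlinarith

theorem wallDensity_eq {k : ℝ} (hk0 : k ≠ 0) (ω L : ℝ) :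
    wallDensity k ω L = unifiedDensity k ω L := by
  ext t
  simp [wallDensity, unifiedDensity, wallConst, hk0]

/-! ### The value of the minimal energy -/

theorem energy_value_eq {k ω h S : ℝ} (hk : k ∈ Ioo (-1 : ℝ) 1) (hk0 : k ≠ 0) (hh : 0 < h)
    (hω : -h ≤ ω) (hm : UnitMass k ω h)
    (hS : 1 / 2 * (ω + 2 * h) ^ 2 - ∫ y, rieszReal k (ω + 2 * h - y)
      ∂(intervalMeasure ω (2 * h) (unifiedDensity k ω (2 * h))) = S) :
    S + (∫ x, x ^ 2 ∂(intervalMeasure ω (2 * h) (unifiedDensity k ω (2 * h)))) / 2 =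
      wallEnergyValue' k ω (2 * h) := by
  rw [(hasIntegralWrt_potential_right hk hk0 hh hω).2] at hS
  rw [(hasIntegralWrt_sq hk hh hω hm).2, ← hS, wallEnergyValue', wallOffset]
  have h1 : 1 - k ≠ 0 := by linarith [hk.2]
  have h4 : 2 - k ≠ 0 := by linarith [hk.2]
  have h5 : 4 - k ≠ 0 := by linarith [hk.2]
  have h2 : (3 - k) * h + (2 - k) * ω ≠ 0 := by nlinarith [hk.2]
  have h3 : 2 * (2 - k) * ω + (3 - k) * (2 * h) = 2 * ((3 - k) * h + (2 - k) * ω) := by ring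
  rw [h3]
  have key : (2 - k) / ((1 - k) * ((3 - k) * h + (2 - k) * ω)) *
        ((ω + h) ^ 2 * ((1 - k) * ω + (2 - k) * h) +
            (-(ω + h) ^ 2 * h + 2 * (ω + h) * h * (h - ((1 - k) * ω + (2 - k) * h)) +
              h ^ 2 * ((1 - k) * ω + (2 - k) * h)) / (2 - k) -
          h ^ 3 * 3 / ((2 - k) * (4 - k))) / 2 =
      ((5 - k) / (8 * (4 - k)) * (2 * h) ^ 3 +
            1 / 4 * ((3 - k) * ω + (1 - k) / 2 * (2 * h)) * (2 * h) ^ 2 +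
          ω / 2 * ((3 - 2 * k) * ω + (1 - k) * (2 * h)) * (2 * h) +
        (2 - k) * ω ^ 2 * (ω + 1 / 2 * (2 * h))) /
      (2 * ((3 - k) * h + (2 - k) * ω)) := by
    generalize (3 - k) * h + (2 - k) * ω = D at *
    field_simp
    ring
  rw [key]
  field_simp
  ring

/-- The unit-mass condition turns the Gamma quotient times `L ^ (1 - k)` into a rational function;
the rest is algebra. -/
theorem wallEnergyValue_eq {k ω h : ℝ} (hk : k ∈ Ioo (-1 : ℝ) 1) (hk0 : k ≠ 0) (hh : 0 < h)
    (hω : -h ≤ ω) (hm : UnitMass k ω h) :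
    wallEnergyValue k ω (2 * h) = wallEnergyValue' k ω (2 * h) := by
  have h1 : 1 - k ≠ 0 := by linarith [hk.2]
  have h4 : 2 - k ≠ 0 := by linarith [hk.2]
  have h4' : k - 2 ≠ 0 := by linarith [hk.2]
  have h5 : 4 - k ≠ 0 := by linarith [hk.2]
  have h2 : (3 - k) * h + (2 - k) * ω ≠ 0 := by nlinarith [hk.2]
  have hcoef := hm.coeff_eq hk hh hω
  have e : (2 : ℝ) ^ (k - 2) * 2 ^ (1 - k) = 1 / 2 := by
    rw [← Real.rpow_add two_pos, show k - 2 + (1 - k) = -1 by ring, Real.rpow_neg_one]; norm_num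
  have hfac : √Real.pi * 2 ^ (k - 2) * Real.Gamma (1 / 2 - k / 2) /
      (|k| * wallC k * Real.Gamma (1 - k / 2)) * (2 * h) ^ (1 - k) =
      (2 - k) / ((1 - k) * (2 * ((3 - k) * h + (2 - k) * ω))) := by
    rw [mul_left_comm (1 - k), div_mul_eq_div_div_swap _ (2 : ℝ), ← hcoef,
      gegenbauerMass_eq (half_one_sub_mem hk).1, wallConst, if_neg hk0,
      show 1 / 2 - k / 2 = (1 - k) / 2 by ring, show (1 - k) / 2 + 1 / 2 = 1 - k / 2 by ring,
      Real.mul_rpow two_pos.le hh.le]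
    linear_combination (√Real.pi * Real.Gamma ((1 - k) / 2) /
      (|k| * wallC k * Real.Gamma (1 - k / 2)) * h ^ (1 - k)) * e
  unfold wallEnergyValue wallEnergyValue'
  rw [mul_assoc _ (_ / _) ((2 * h) ^ (1 - k)), hfac,
    show 2 * (2 - k) * ω + (3 - k) * (2 * h) = 2 * ((3 - k) * h + (2 - k) * ω) by ring,
    show k ^ 2 - 6 * k + 8 = (2 - k) * (4 - k) by ring]
  congr 1
  generalize (3 - k) * h + (2 - k) * ω = D at *
  rw [show k - 1 = -(1 - k) by ring, show k - 2 = -(2 - k) by ring]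
  field_simp
  ring

/-! ### The logarithmic case -/

/-- For `k = 0` the unit-mass condition is the quadratic `h * (3 * h + 2 * ω) = 2`, whose positive
root is half of `logWallLength ω`. -/
theorem unitMass_zero {ω : ℝ} : 0 < logWallLength ω ∧ UnitMass 0 ω (logWallLength ω / 2) := by
  have h6 : 0 ≤ ω ^ 2 + 6 := by positivity
  have hs := Real.sq_sqrt h6
  have hlt : ω < √(ω ^ 2 + 6) := Real.lt_sqrt_of_sq_lt (by linarith)
  constructor
  · unfold logWallLength; nlinarith
  · unfold UnitMass logWallLength
    rw [wallConst, if_pos rfl, sub_zero, gegenbauerMass_half, Real.rpow_one]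
    linear_combination (Real.pi / 3) * hs

theorem neg_le_half_logWallLength {ω : ℝ} (hω : -√2 ≤ ω) : -(logWallLength ω / 2) ≤ ω := by
  unfold logWallLength
  rcases le_total 0 ω with h | h
  · have := Real.sqrt_nonneg (ω ^ 2 + 6)
    have hlt : ω ≤ √(ω ^ 2 + 6) := Real.le_sqrt_of_sq_le (by linarith)
    linarith
  · have h2 : ω ^ 2 ≤ 2 := by
      nlinarith [Real.sq_sqrt (show (0 : ℝ) ≤ 2 by norm_num), Real.sqrt_nonneg 2]
    have : -(2 * ω) ≤ √(ω ^ 2 + 6) := Real.le_sqrt_of_sq_le (by nlinarith)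
    linarith

/-- Equality persists at `t = ω`, where division by zero and the negative power of zero both give
`0`. -/
theorem logWallDensity_eq {ω t : ℝ} (ht : t ∈ Icc ω (ω + logWallLength ω)) :
    logWallDensity ω t = unifiedDensity 0 ω (logWallLength ω) t := by
  have h1 : 0 ≤ logWallLength ω + ω - t := by linarith [ht.2]
  have h2 : 0 ≤ t - ω := by linarith [ht.1]
  have hpi := Real.pi_pos.ne'
  rw [logWallDensity, unifiedDensity, wallConst, if_pos rfl, Real.sqrt_div h1, Real.sqrt_eq_rpow,
    Real.sqrt_eq_rpow, add_zero, sub_zero, Real.rpow_neg h2, zero_mul, sub_zero]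
  field_simp

theorem intervalMeasure_log_eq (ω : ℝ) :
    intervalMeasure ω (logWallLength ω) (logWallDensity ω) =
      intervalMeasure ω (logWallLength ω) (unifiedDensity 0 ω (logWallLength ω)) := by
  refine withDensity_congr_ae ?_
  filter_upwards [ae_restrict_mem measurableSet_Icc] with t ht
  rw [logWallDensity_eq ht]

/-! ### Assembly -/

theorem riesz_wall_equilibrium {k ω h : ℝ} (hk : k ∈ Ioo (-1 : ℝ) 1) (hk0 : k ≠ 0) (hh : 0 < h)
    (hω : -h ≤ ω) (hm : UnitMass k ω h) {ν : Measure ℝ}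
    (hν : ν = intervalMeasure ω (2 * h) (wallDensity k ω (2 * h))) :
    IsProbabilityMeasure ν ∧ ν.support = Icc ω (ω + 2 * h) ∧
    (∀ x, ω ≤ x → Integrable (fun y => |x - y| ^ k) ν) ∧
    (∃ S : ℝ,
      (∀ x ∈ Icc ω (ω + 2 * h), 1 / 2 * x ^ 2 - Real.sign k * ∫ y, |x - y| ^ k ∂ν = S) ∧
      (∀ x, ω + 2 * h ≤ x → S ≤ 1 / 2 * x ^ 2 - Real.sign k * ∫ y, |x - y| ^ k ∂ν)) ∧
    IsWallEquilibrium k ω ν ∧ wallEnergy k ω = ((wallEnergyValue k ω (2 * h) : ℝ) : EReal) := by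
  rw [wallDensity_eq hk0] at hν
  obtain ⟨h1, h2, h3, S, h4, h5, h6, h7⟩ := wall_equilibrium hk hh hω hm hν
  have hV : ∀ x y, rieszReal k (x - y) = Real.sign k * |x - y| ^ k := fun x y => by
    simp [rieszReal, hk0]
  have hE := energy_value_eq (S := S) hk hk0 hh hω hm (by
    rw [← hν]; exact h4 _ ⟨by linarith, le_rfl⟩)
  rw [← hν] at hE
  simp only [hV, integral_const_mul] at h3 h4 h5
  refine ⟨h1, h2, fun x hx => ?_, ⟨S, h4, h5⟩, h6, ?_⟩
  · refine ((h3 x hx).const_mul (Real.sign k)).congr (Filter.Eventually.of_forall fun y => ?_)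
    simp only
    rw [← mul_assoc, sign_mul_sign_of_ne_zero hk0, one_mul]
  · rw [h7, hE, wallEnergyValue_eq hk hk0 hh hω hm]

theorem mainTheorem5 :
    (∀ k ∈ Ioo (-1 : ℝ) 1, k ≠ 0 → ∀ ω : ℝ,
      ∃ L : ℝ, (0 < L ∧ WallLengthEq k ω L) ∧ (∀ x : ℝ, 0 < x → WallLengthEq k ω x → x = L) ∧
        (-criticalWall k ≤ ω →
          (∀ t ∈ Icc ω (ω + L), 0 ≤ wallDensity k ω L t) ∧
          IsProbabilityMeasure (intervalMeasure ω L (wallDensity k ω L)) ∧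
          (intervalMeasure ω L (wallDensity k ω L)).support = Icc ω (ω + L) ∧
          (∀ x : ℝ, ω ≤ x →
            Integrable (fun y => |x - y| ^ k) (intervalMeasure ω L (wallDensity k ω L))) ∧
          (∃ S : ℝ,
            (∀ x ∈ Icc ω (ω + L),
              1 / 2 * x ^ 2 - Real.sign k *
                ∫ y, |x - y| ^ k ∂(intervalMeasure ω L (wallDensity k ω L)) = S) ∧
            (∀ x : ℝ, ω + L ≤ x →
              S ≤ 1 / 2 * x ^ 2 - Real.sign k *
                ∫ y, |x - y| ^ k ∂(intervalMeasure ω L (wallDensity k ω L)))) ∧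
          IsWallEquilibrium k ω (intervalMeasure ω L (wallDensity k ω L)) ∧
          wallEnergy k ω = ((wallEnergyValue k ω L : ℝ) : EReal) ∧
          wallEnergyValue k ω L = wallEnergyValue' k ω L)) ∧
    (∀ ω : ℝ, -√2 ≤ ω →
      0 < logWallLength ω ∧
      (∀ t ∈ Icc ω (ω + logWallLength ω), 0 ≤ logWallDensity ω t) ∧
      IsProbabilityMeasure (intervalMeasure ω (logWallLength ω) (logWallDensity ω)) ∧
      (intervalMeasure ω (logWallLength ω) (logWallDensity ω)).support =
        Icc ω (ω + logWallLength ω) ∧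
      (∀ x : ℝ, ω ≤ x →
        Integrable (fun y => Real.log |x - y|)
          (intervalMeasure ω (logWallLength ω) (logWallDensity ω))) ∧
      (∃ S : ℝ,
        (∀ x ∈ Icc ω (ω + logWallLength ω),
          1 / 2 * x ^ 2 -
            ∫ y, Real.log |x - y| ∂(intervalMeasure ω (logWallLength ω) (logWallDensity ω)) = S) ∧
        (∀ x : ℝ, ω + logWallLength ω ≤ x →
          S ≤ 1 / 2 * x ^ 2 -
            ∫ y, Real.log |x - y| ∂(intervalMeasure ω (logWallLength ω) (logWallDensity ω)))) ∧
      IsWallEquilibrium 0 ω (intervalMeasure ω (logWallLength ω) (logWallDensity ω))) := by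
  refine ⟨fun k hk hk0 ω => ?_, fun ω hω => ?_⟩
  · obtain ⟨h, hh, heq, huniq⟩ := existsUnique_rpow_mul_linear (α := 1 - k) (a := 3 - k)
      (b := (2 - k) * ω) (by linarith [hk.2]) (by linarith [hk.2]) (criticalValue_pos hk hk0)
    have hlen := (wallLengthEq_iff (ω := ω) hh).2 heq
    refine ⟨2 * h, ⟨by positivity, hlen⟩, fun x hx hxeq => ?_, fun hω => ?_⟩
    · have hx2 : x = 2 * (x / 2) := by ring
      rw [hx2, wallLengthEq_iff (half_pos hx)] at hxeq
      rw [hx2, huniq _ (half_pos hx) hxeq]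
    · have hω' := neg_le_of_criticalWall hk hk0 hh heq hω
      have hm := (unitMass_iff hk hk0 hh).2 hlen
      obtain ⟨h1, h2, h3, h4, h5, h6⟩ := riesz_wall_equilibrium hk hk0 hh hω' hm rfl
      refine ⟨fun t ht => ?_, h1, h2, h3, h4, h5, h6, wallEnergyValue_eq hk hk0 hh hω' hm⟩
      rw [wallDensity_eq hk0]
      exact unifiedDensity_nonneg hk (by linarith) t ht
  · obtain ⟨hL, hm⟩ := unitMass_zero (ω := ω)
    have hω' := neg_le_half_logWallLength hω
    have hk : (0 : ℝ) ∈ Ioo (-1 : ℝ) 1 := by norm_num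
    have h2L : 2 * (logWallLength ω / 2) = logWallLength ω := by ring
    obtain ⟨h1, h2, h3, S, h4, h5, h6, -⟩ := wall_equilibrium hk (half_pos hL) hω' hm
      rfl
    have hV : ∀ x y, rieszReal 0 (x - y) = Real.log |x - y| := fun x y => by simp [rieszReal]
    simp only [hV, h2L, ← intervalMeasure_log_eq] at h1 h2 h3 h4 h5 h6
    refine ⟨hL, fun t ht => ?_, h1, h2, h3, ⟨S, h4, h5⟩, h6⟩
    rw [logWallDensity_eq ht]
    exact unifiedDensity_nonneg hk (by linarith) t ht
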